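/- Let $n\ge 0$ be an integer and let $\lambda\in\mathbb{C}$, $\lambda\neq 0$. Write $R_-^n=\mathbb{R}^n[t^{-1}]t^{-1}$, with elements $x=\sum_{i\ge 1}x_{-i}t^{-i}$ (finite sums, $x_{-i}\in\mathbb{R}^n$ with coordinates $x_{-i}^u$, $1\le u\le n$). A function $f:R_-^n\to\mathbb{C}$ is called Schwartz if its restriction to every finite-dimensional real subspace of $R_-^n$ is a Schwartz function; let $\mathcal{S}(R_-^n)$ be the space of these functions. Let $\pi_t$ be the integral operator $$\pi_t f(x_{-1},x_{-2},\dots)=\int_{\mathbb{R}^n} f(y,x_{-1},x_{-2},\dots)\,dy ,$$ and let $\mathcal{S}(R_-^n)_\lambda=\{f\in\mathcal{S}(R_-^n) : \pi_t f=\lambda f\}$. Let $\mathfrak{g}=\mathfrak{sl}_n(\mathbb{C})$ and let $\hat{\mathfrak{g}}=\mathfrak{g}\otimes\mathbb{C}[t,t^{-1}]\oplus\mathbb{C}K$ be the affine Kac–Moody algebra, in which $K$ is central and $$[at^m,bt^p]=[a,b]t^{m+p}+m\,\delta_{m+p,0}\operatorname{tr}(ab)\,K .$$ Then there is a unique linear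 map $\pi:\hat{\mathfrak{g}}\to\operatorname{End}(\mathcal{S}(R_-^n)_\lambda)$ such that $\pi(K)=\mathrm{id}$ and, with $E_{uv}$ the matrix units: (1) for $j\ge 0$ and $a=(a_{uv})\in\mathfrak{g}$, $\ \pi(at^j)=\sum_{u,v}a_{uv}\bigl(-\sum_{i=1}^\infty x_{-i-j}^v\,\partial_{x_{-i}^u}\bigr)$; (2) for $j>0$ and $u\ne v$, $\ \pi(E_{uv}t^{-j})=-\lambda^{-j}\pi_t^j\sum_{i=1}^\infty x_{-i}^v\,\partial_{x_{-i-j}^u}$; (3) for $j>0$ and $u\ne v$, $\ \pi((E_{uu}-E_{vv})t^{-j})=-\lambda^{-j}\pi_t^j\sum_{i=1}^\infty\bigl(x_{-i}^u\,\partial_{x_{-i-j}^u}-x_{-i}^v\,\partial_{x_{-i-j}^v}\bigr)$. In particular these operators preserve $\mathcal{S}(R_-^n)_\lambda$. Moreover $\pi$ is a homomorphism of Lie algebras, i.e. a representation of $\hat{\mathfrak{g}}$ on $\mathcal{S}(R_-^n)_\lambda$ with central charge $1$. -/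

import Mathlib

open MeasureTheory LieAlgebra
open scoped SchwartzMap TensorProduct

attribute [local instance 100] LieRing.ofAssociativeRing

noncomputable section

/-- The real vector space `R_-^n = ℝⁿ[t⁻¹]t⁻¹`.  An element is written `x = ∑_{i ≥ 1} x_{-i} t^{-i}`
with finitely many nonzero `x_{-i} ∈ ℝⁿ`; the value `x k` for `k : ℕ` is the coefficient of
`t^{-(k+1)}`, so the coordinate `x_{-i}^u` is `x (i - 1) u`. -/
abbrev NegLoop (n : ℕ) : Type := ℕ →₀ (Fin n → ℝ)

namespace NegLoop

variable {n : ℕ}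

/-- The vector `e_u t^{-(k+1)}`. -/
def basisVec (k : ℕ) (u : Fin n) : NegLoop n := Finsupp.single k (Pi.single u 1)

/-- Multiplication by `t⁻¹` on `R_-^n`. -/
def mulTInv : NegLoop n →ₗ[ℝ] NegLoop n := Finsupp.lmapDomain (Fin n → ℝ) ℝ (fun k => k + 1)

/-- The partial derivative of `f` with respect to the coordinate `x_{-(k+1)}^u`. -/
def partialDeriv (k : ℕ) (u : Fin n) (f : NegLoop n → ℂ) (x : NegLoop n) : ℂ :=
  lineDeriv ℝ f x (basisVec k u)

/-- A function on `R_-^n` is a Schwartz function if its restriction to every finite dimensional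
subspace is one.  The subspaces are parametrized by injective linear maps from `ℝ^N`. -/
def IsSchwartz (f : NegLoop n → ℂ) : Prop :=
  ∀ (N : ℕ) (L : EuclideanSpace ℝ (Fin N) →ₗ[ℝ] NegLoop n), Function.Injective L →
    ∃ φ : 𝓢(EuclideanSpace ℝ (Fin N), ℂ), ∀ y, φ y = f (L y)

/-- The integral operator `π_t`:
`(π_t f)(x) = ∫_{ℝⁿ} f(t⁻¹ x + y t⁻¹) dy`, that is
`(π_t f)(x_{-1}, x_{-2}, …) = ∫_{ℝⁿ} f(y, x_{-1}, x_{-2}, …) dy`. -/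
def piT (f : NegLoop n → ℂ) (x : NegLoop n) : ℂ :=
  ∫ y : Fin n → ℝ, f (mulTInv x + Finsupp.single 0 y)

lemma IsSchwartz.integrable_comp {f : NegLoop n → ℂ} (hf : IsSchwartz f) {N : ℕ}
    (L : EuclideanSpace ℝ (Fin N) →ₗ[ℝ] NegLoop n) (hL : Function.Injective L)
    (A : (Fin n → ℝ) →ₗ[ℝ] EuclideanSpace ℝ (Fin N)) (hA : Function.Injective A)
    (b : EuclideanSpace ℝ (Fin N)) :
    Integrable (fun y : Fin n → ℝ => f (L (A y + b))) := by
  obtain ⟨φ, hφ⟩ := hf N L hL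
  obtain ⟨K, -, hK⟩ := A.injective_iff_antilipschitz.mp hA
  have hK' : AntilipschitzWith K (fun y => A y + b) := fun x y => by
    simpa [edist_add_right] using hK x y
  have hg : (fun y => A y + b).HasTemperateGrowth := by
    have := (LinearMap.toContinuousLinearMap A).hasTemperateGrowth
    exact this.add (Function.HasTemperateGrowth.const b)
  have h := (SchwartzMap.compCLMOfAntilipschitz ℝ hg hK' φ).integrable (μ := volume)
  refine h.congr (Filter.Eventually.of_forall fun y => ?_)
  simp [hφ]

/-- The integral defining `π_t f` converges for every Schwartz function `f`. -/
lemma IsSchwartz.integrable_piT {f : NegLoop n → ℂ} (hf : IsSchwartz f) (x : NegLoop n) :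
    Integrable (fun y : Fin n → ℝ => f (mulTInv x + Finsupp.single 0 y)) := by
  by_cases hx : mulTInv x = 0
  · have := hf.integrable_comp (N := n)
      (Finsupp.lsingle 0 ∘ₗ (WithLp.linearEquiv 2 ℝ (Fin n → ℝ)).toLinearMap)
      ((Finsupp.single_injective 0).comp (WithLp.linearEquiv 2 ℝ (Fin n → ℝ)).injective)
      (WithLp.linearEquiv 2 ℝ (Fin n → ℝ)).symm.toLinearMap
      (WithLp.linearEquiv 2 ℝ (Fin n → ℝ)).symm.injective 0
    simpa [hx] using this
  · have h0 : (mulTInv x) 0 = 0 := by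
      change Finsupp.mapDomain (fun k => k + 1) x 0 = 0
      exact Finsupp.mapDomain_of_notMem_range _ _ (by simp)
    let L : EuclideanSpace ℝ (Fin (n + 1)) →ₗ[ℝ] NegLoop n :=
      { toFun := fun z => z 0 • mulTInv x + Finsupp.single 0 (fun u => z u.succ)
        map_add' := fun z w => by
          rw [show (fun u : Fin n => (z + w) u.succ) =
            (fun u => z u.succ) + (fun u => w u.succ) from rfl, Finsupp.single_add]
          simp only [PiLp.add_apply, add_smul]
          abel
        map_smul' := fun c z => by
          rw [show (fun u : Fin n => (c • z) u.succ) = c • (fun u => z u.succ) from rfl,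
            ← Finsupp.smul_single]
          simp [mul_smul] }
    let A : (Fin n → ℝ) →ₗ[ℝ] EuclideanSpace ℝ (Fin (n + 1)) :=
      { toFun := fun y => WithLp.toLp 2 (Fin.cons 0 y)
        map_add' := fun y z => by
          ext i
          refine Fin.cases ?_ (fun _ => ?_) i <;> simp
        map_smul' := fun c y => by
          ext i
          refine Fin.cases ?_ (fun _ => ?_) i <;> simp }
    have hL : Function.Injective L := by
      rw [← LinearMap.ker_eq_bot, LinearMap.ker_eq_bot']
      intro z hz
      change z 0 • mulTInv x + Finsupp.single 0 (fun u => z u.succ) = 0 at hz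
      have h1 : (fun u : Fin n => z u.succ) = 0 := by
        have := DFunLike.congr_fun hz 0
        simpa [h0] using this
      rw [h1, Finsupp.single_zero, add_zero, smul_eq_zero] at hz
      ext i
      refine Fin.cases ?_ (fun u => ?_) i
      · exact hz.resolve_right hx
      · exact congrFun h1 u
    have hA : Function.Injective A := by
      intro y z h
      funext u
      have := congrArg (fun w : EuclideanSpace ℝ (Fin (n + 1)) => w u.succ) h
      simpa [A] using this
    have := hf.integrable_comp L hL A hA (WithLp.toLp 2 (Fin.cons 1 0))
    refine this.congr (Filter.Eventually.of_forall fun y => ?_)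
    simp [L, A]

/-- The space `S(R_-^n)` of Schwartz functions on `R_-^n`. -/
def schwartzSpace (n : ℕ) : Submodule ℂ (NegLoop n → ℂ) where
  carrier := {f | IsSchwartz f}
  zero_mem' := fun _ _ _ => ⟨0, fun _ => rfl⟩
  add_mem' := fun {f g} hf hg N L hL => by
    obtain ⟨φ, hφ⟩ := hf N L hL
    obtain ⟨ψ, hψ⟩ := hg N L hL
    exact ⟨φ + ψ, fun y => by simp [hφ, hψ]⟩
  smul_mem' := fun c f hf N L hL => by
    obtain ⟨φ, hφ⟩ := hf N L hL
    exact ⟨c • φ, fun y => by simp [hφ]⟩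

/-- The eigenspace `S(R_-^n)_lam = {f ∈ S(R_-^n) | π_t f = lam f}`. -/
def schwartzEigenspace (n : ℕ) (lam : ℂ) : Submodule ℂ (NegLoop n → ℂ) where
  carrier := {f | f ∈ schwartzSpace n ∧ piT f = lam • f}
  zero_mem' := ⟨Submodule.zero_mem _, by funext x; simp [piT]⟩
  add_mem' := fun {f g} hf hg => by
    refine ⟨Submodule.add_mem _ hf.1 hg.1, ?_⟩
    rw [smul_add, ← hf.2, ← hg.2]
    funext x
    exact integral_add (IsSchwartz.integrable_piT hf.1 x) (IsSchwartz.integrable_piT hg.1 x)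
  smul_mem' := fun c f hf => by
    refine ⟨Submodule.smul_mem _ c hf.1, ?_⟩
    rw [smul_comm, ← hf.2]
    funext x
    exact integral_const_mul c _

/-- The operator `-∑_{i ≥ 1} x_{-i-j}^v ∂_{x_{-i}^u}`, for `j ≥ 0`.  At every point the sum has only
finitely many nonzero terms. -/
def nonnegModeOp (u v : Fin n) (j : ℕ) (f : NegLoop n → ℂ) (x : NegLoop n) : ℂ :=
  -∑ᶠ k : ℕ, (x (k + j) v : ℂ) * partialDeriv k u f x

/-- The operator `∑_{i ≥ 1} x_{-i}^v ∂_{x_{-i-j}^u}`.  At every point the sum has only finitely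
many nonzero terms. -/
def loweringSum (u v : Fin n) (j : ℕ) (f : NegLoop n → ℂ) (x : NegLoop n) : ℂ :=
  ∑ᶠ k : ℕ, (x k v : ℂ) * partialDeriv (k + j) u f x

/-- The operator `-lam^{-j} π_t^j ∑_{i ≥ 1} x_{-i}^v ∂_{x_{-i-j}^u}`. -/
def negModeOffDiag (lam : ℂ) (u v : Fin n) (j : ℕ) (f : NegLoop n → ℂ) : NegLoop n → ℂ :=
  (-(lam ^ j)⁻¹) • piT^[j] (loweringSum u v j f)

/-- The operator
`-lam^{-j} π_t^j ∑_{i ≥ 1} (x_{-i}^u ∂_{x_{-i-j}^u} - x_{-i}^v ∂_{x_{-i-j}^v})`. -/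
def negModeDiag (lam : ℂ) (u v : Fin n) (j : ℕ) (f : NegLoop n → ℂ) : NegLoop n → ℂ :=
  (-(lam ^ j)⁻¹) • piT^[j] (fun x => ∑ᶠ k : ℕ,
    ((x k u : ℂ) * partialDeriv (k + j) u f x - (x k v : ℂ) * partialDeriv (k + j) v f x))

end NegLoop

namespace AffineSl

/-- The Lie algebra `sl_n(ℂ)`. -/
abbrev Sl (n : ℕ) : Type := SpecialLinear.sl (Fin n) ℂ

/-- The bilinear form `(a, b) = tr(ab)` on `sl_n(ℂ)`. -/
def traceForm (n : ℕ) : LinearMap.BilinForm ℂ (Sl n) :=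
  LinearMap.mk₂ ℂ (fun a b => (a.val * b.val).trace)
    (fun a b c => by simp [add_mul]) (fun r a b => by simp)
    (fun a b c => by simp [mul_add]) (fun r a b => by simp)

lemma traceForm_apply {n : ℕ} (a b : Sl n) : traceForm n a b = (a.val * b.val).trace := rfl

lemma neg_traceForm_isSymm (n : ℕ) : (-traceForm n).IsSymm :=
  ⟨fun a b => by simp [traceForm_apply, Matrix.trace_mul_comm a.val b.val]⟩

lemma neg_traceForm_lieInvariant (n : ℕ) : (-traceForm n).lieInvariant (Sl n) := by
  intro a b c
  have h := Matrix.trace_mul_comm a.val (b.val * c.val)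
  simp only [LinearMap.neg_apply, traceForm_apply, SpecialLinear.sl_bracket, sub_mul, mul_sub,
    Matrix.trace_sub, mul_assoc] at h ⊢
  rw [h]
  ring

/-- The affine Kac–Moody algebra `sl_n ⊗ ℂ[t, t⁻¹] ⊕ ℂK`, the central extension of the loop
algebra whose bracket is given by `lie_mode_mode` and `lie_K` below.
(Mathlib's cocycle attached to a form `Φ` sends `(a t^m, b t^p)` to `p δ_{m+p,0} Φ(a, b)`, which
for `Φ = -tr` is `m δ_{m+p,0} tr(ab)`.) -/
abbrev Affine (n : ℕ) : Type :=
  LieAlgebra.ofTwoCocycle (LoopAlgebra.twoCocycleOfBilinear ℂ ℤ (Sl n) (-traceForm n)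
    (neg_traceForm_lieInvariant n) (neg_traceForm_isSymm n))

variable {n : ℕ}

/-- The element `a t^m` of the affine algebra. -/
def mode (a : Sl n) (m : ℤ) : Affine n :=
  LieAlgebra.ofProd _ (AddMonoidAlgebra.single m 1 ⊗ₜ[ℂ] a, 0)

/-- The central element `K` of the affine algebra. -/
def K (n : ℕ) : Affine n :=
  LieAlgebra.ofProd _ (0, (TrivialLieModule.equiv ℂ (loopAlgebra ℂ ℤ (Sl n)) ℂ).symm 1)

/-- `[a t^m, b t^p] = [a, b] t^{m+p} + m δ_{m+p,0} tr(ab) K`. -/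
lemma lie_mode_mode (a b : Sl n) (m p : ℤ) :
    ⁅mode a m, mode b p⁆ =
      mode ⁅a, b⁆ (m + p) + (if m + p = 0 then (m : ℂ) * (a.val * b.val).trace else 0) • K n := by
  have h : (⁅(AddMonoidAlgebra.single m 1 ⊗ₜ[ℂ] a : loopAlgebra ℂ ℤ (Sl n)),
      (AddMonoidAlgebra.single p 1 ⊗ₜ[ℂ] b : loopAlgebra ℂ ℤ (Sl n))⁆) =
      AddMonoidAlgebra.single (m + p) 1 ⊗ₜ[ℂ] ⁅a, b⁆ := by
    rw [LieAlgebra.ExtendScalars.bracket_tmul, AddMonoidAlgebra.single_mul_single, one_mul]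
  have hc : LoopAlgebra.residuePairing ℂ ℤ (Sl n) (-traceForm n)
      (AddMonoidAlgebra.single m 1 ⊗ₜ[ℂ] a) (AddMonoidAlgebra.single p 1 ⊗ₜ[ℂ] b) =
      if m + p = 0 then (m : ℂ) * (a.val * b.val).trace else 0 := by
    rw [LoopAlgebra.residuePairing_apply_apply, LoopAlgebra.toFinsupp_single_tmul,
      LoopAlgebra.toFinsupp_single_tmul, Finsupp.sum_single_index (by simp)]
    by_cases hmp : m + p = 0
    · obtain rfl : p = -m := by omega
      simp [traceForm_apply]
    · rw [if_neg hmp, Finsupp.single_eq_of_ne (by omega)]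
      simp
  set c := LoopAlgebra.twoCocycleOfBilinear ℂ ℤ (Sl n) (-traceForm n)
    (neg_traceForm_lieInvariant n) (neg_traceForm_isSymm n)
  set r : ℂ := if m + p = 0 then (m : ℂ) * (a.val * b.val).trace else 0
  let e := TrivialLieModule.equiv ℂ (loopAlgebra ℂ ℤ (Sl n)) ℂ
  have h1 : ⁅mode a m, mode b p⁆ = LieAlgebra.ofProd c
      (⁅(AddMonoidAlgebra.single m 1 ⊗ₜ[ℂ] a : loopAlgebra ℂ ℤ (Sl n)),
        (AddMonoidAlgebra.single p 1 ⊗ₜ[ℂ] b : loopAlgebra ℂ ℤ (Sl n))⁆,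
        e.symm (LoopAlgebra.residuePairing ℂ ℤ (Sl n) (-traceForm n)
          (AddMonoidAlgebra.single m 1 ⊗ₜ[ℂ] a) (AddMonoidAlgebra.single p 1 ⊗ₜ[ℂ] b)) + 0 - 0) :=
    rfl
  have h2 : mode ⁅a, b⁆ (m + p) + r • K n = LieAlgebra.ofProd c
      (AddMonoidAlgebra.single (m + p) 1 ⊗ₜ[ℂ] ⁅a, b⁆ + r • 0, 0 + r • e.symm 1) := rfl
  rw [h1, h2, h, hc, ← map_smul]
  simp

/-- `K` is central. -/
lemma lie_K (x : Affine n) : ⁅x, K n⁆ = 0 := by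
  rw [LieAlgebra.bracket_ofTwoCocycle]
  simp only [K, Equiv.symm_apply_apply, lie_zero, trivial_lie_zero, map_zero, sub_zero,
    add_zero]
  rfl

/-- The linear map `ρ` from the affine algebra to the endomorphisms of the eigenspace
`S(R_-^n)_lam` is given on the modes by the explicit operators. -/
structure HasModeFormulas (lam : ℂ)
    (ρ : Affine n →ₗ[ℂ] Module.End ℂ (NegLoop.schwartzEigenspace n lam)) : Prop where
  /-- For `j ≥ 0`, `a t^j` acts by the linear extension in `a` of
  `E_{uv} t^j ↦ -∑_{i ≥ 1} x_{-i-j}^v ∂_{x_{-i}^u}`. -/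
  nonneg : ∀ (a : Sl n) (j : ℕ) (f : NegLoop.schwartzEigenspace n lam),
    (ρ (mode a j) f : NegLoop n → ℂ) =
      ∑ u : Fin n, ∑ v : Fin n, a.val u v • NegLoop.nonnegModeOp u v j f
  /-- For `j > 0` and `u ≠ v`, `E_{uv} t^{-j}` acts by
  `-lam^{-j} π_t^j ∑_{i ≥ 1} x_{-i}^v ∂_{x_{-i-j}^u}`. -/
  neg_offDiag : ∀ (u v : Fin n) (huv : u ≠ v) (j : ℕ), 0 < j →
    ∀ f : NegLoop.schwartzEigenspace n lam,
      (ρ (mode (SpecialLinear.single u v huv 1) (-j)) f : NegLoop n → ℂ) =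
        NegLoop.negModeOffDiag lam u v j f
  /-- For `j > 0` and `u ≠ v`, `(E_{uu} - E_{vv}) t^{-j}` acts by
  `-lam^{-j} π_t^j ∑_{i ≥ 1} (x_{-i}^u ∂_{x_{-i-j}^u} - x_{-i}^v ∂_{x_{-i-j}^v})`. -/
  neg_diag : ∀ (u v : Fin n), u ≠ v → ∀ j : ℕ, 0 < j →
    ∀ f : NegLoop.schwartzEigenspace n lam,
      (ρ (mode (SpecialLinear.singleSubSingle u v 1) (-j)) f : NegLoop n → ℂ) =
        NegLoop.negModeDiag lam u v j f

end AffineSl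

end

/-! Each linear map `T` of R_-^n gives a vector field and an operator D_T f(x) = df_x(Tx) on
Schwartz functions, with [D_S, D_T] = D_{TS - ST}. Hence T ↦ -D_T respects brackets. Letting `a t^m`
act on R_-^n, with nonnegative powers of t discarded, would therefore give a representation of the
loop algebra if truncation were compatible with composition. It is not, but the defect
(`unitMode_comp`) is a sum of rank one fields ℓ(x)∂_w with w among the first (-m)^+ coefficient
directions.

Powers of π_t turn these defects into scalars. By the Leibniz rule ℓ∂_w = ∂_w ℓ - ℓ(w), and π_t^q
∂_w = 0 when w lies in the first q directions, because the integral of a derivative along the fibre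
vanishes. So π_t^q ℓ∂_w = -ℓ(w) π_t^q (`piTEnd_pow_mul_fieldDeriv_smulRight`). The two orders of
composition contribute (-m)^+ and (-p)^+ copies of tr(ab), only if m + p = 0, and then (-p)^+ -
(-m)^+ = m. This is the cocycle (`piTEnd_pow_mul_modeDeriv_comm`).

The field of `a t^m` also commutes with π_t up to one rank one field. After π_t^{(-m)^+} this costs
a multiple of tr(a), which is zero (`piTEnd_pow_mul_modeDeriv_mul_piTEnd_pow`). So the eigenspace is
preserved, and all powers of π_t in a product collect on the left, where on an eigenfunction the
surplus powers become powers of λ cancelling the normalization (`modeAction_comm`).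

Uniqueness is linear algebra: the modes and `K` span, and the listed matrices span sl_n. -/

noncomputable section

/-! ### Partial integration of Schwartz functions on a product. -/

namespace SchwartzMap

section PartialIntegral

variable {W Y E : Type} [NormedAddCommGroup W] [NormedSpace ℝ W]
  [NormedAddCommGroup Y] [NormedSpace ℝ Y] [NormedAddCommGroup E] [NormedSpace ℝ E]

/-- The derivative of a Schwartz function on a product with respect to the first variable. -/
def fderivFst (f : 𝓢(W × Y, E)) : 𝓢(W × Y, W →L[ℝ] E) :=
  (fderivCLM ℝ (W × Y) E f).postcompCLM
    ((ContinuousLinearMap.compL ℝ W (W × Y) E).flip (ContinuousLinearMap.inl ℝ W Y))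

lemma hasFDerivAt_fst (f : 𝓢(W × Y, E)) (w : W) (y : Y) :
    HasFDerivAt (fun w => f (w, y)) (f.fderivFst (w, y)) w :=
  (f.hasFDerivAt (w, y)).comp w (hasFDerivAt_prodMk_left w y)

/-- Decay of order k + r in the pair (w, y) is split: k powers absorb the weight in w, and the
remaining r make the bound integrable in y. The bound does not depend on w, so it serves both
dominated differentiation and decay of the integral. -/
lemma exists_integrable_bound_slice [MeasurableSpace Y] (μ : Measure Y) [μ.HasTemperateGrowth]
    (f : 𝓢(W × Y, E)) (k : ℕ) :
    ∃ B : Y → ℝ, Integrable B μ ∧ ∀ w y, ‖w‖ ^ k * ‖f (w, y)‖ ≤ B y := by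
  set r := μ.integrablePower
  set C := 2 ^ (k + r) * (Finset.Iic (k + r, 0)).sup (fun m => SchwartzMap.seminorm ℝ m.1 m.2) f
  refine ⟨fun y => C * (1 + ‖y‖) ^ (-(r : ℝ)),
    (Measure.integrable_pow_neg_integrablePower μ).const_mul C, fun w y => ?_⟩
  have h := one_add_le_sup_seminorm_apply (𝕜 := ℝ) (m := (k + r, 0)) le_rfl le_rfl f (w, y)
  rw [norm_iteratedFDeriv_zero] at h
  have hy : 0 < (1 + ‖y‖) ^ r := by positivity
  beta_reduce
  rw [Real.rpow_neg (by positivity), Real.rpow_natCast, ← div_eq_mul_inv, le_div_iff₀ hy]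
  refine le_trans ?_ h
  have h1 : ‖w‖ ≤ 1 + ‖(w, y)‖ := by
    have := norm_fst_le (w, y)
    simp only at this
    linarith
  have h2 : 1 + ‖y‖ ≤ 1 + ‖(w, y)‖ := by
    have := norm_snd_le (w, y)
    simp only at this
    linarith
  calc ‖w‖ ^ k * ‖f (w, y)‖ * (1 + ‖y‖) ^ r
      ≤ (1 + ‖(w, y)‖) ^ k * ‖f (w, y)‖ * (1 + ‖(w, y)‖) ^ r := by gcongr
    _ = (1 + ‖(w, y)‖) ^ (k + r) * ‖f (w, y)‖ := by rw [pow_add]; ring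

variable [MeasurableSpace Y] [BorelSpace Y] [SecondCountableTopology Y]
  (μ : Measure Y)

lemma aestronglyMeasurable_slice (f : 𝓢(W × Y, E)) (w : W) :
    AEStronglyMeasurable (fun y => f (w, y)) μ :=
  (f.continuous.comp (by fun_prop : Continuous fun y : Y => (w, y))).aestronglyMeasurable

variable [μ.HasTemperateGrowth]

lemma integrable_slice (f : 𝓢(W × Y, E)) (w : W) : Integrable (fun y => f (w, y)) μ := by
  obtain ⟨B, hB, h⟩ := f.exists_integrable_bound_slice μ 0
  refine hB.mono' (f.aestronglyMeasurable_slice μ w) (Filter.Eventually.of_forall fun y => ?_)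
  simpa using h w y

lemma hasFDerivAt_integral_slice (f : 𝓢(W × Y, E)) (w : W) :
    HasFDerivAt (fun w => ∫ y, f (w, y) ∂μ) (∫ y, f.fderivFst (w, y) ∂μ) w := by
  obtain ⟨B, hB, h⟩ := f.fderivFst.exists_integrable_bound_slice μ 0
  refine hasFDerivAt_integral_of_dominated_of_fderiv_le (s := Set.univ) (bound := B)
    Filter.univ_mem (Filter.Eventually.of_forall fun w => f.aestronglyMeasurable_slice μ w)
    (f.integrable_slice μ w) (f.fderivFst.aestronglyMeasurable_slice μ w)
    (Filter.Eventually.of_forall fun y w _ => ?_) hB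
    (Filter.Eventually.of_forall fun y w _ => f.hasFDerivAt_fst w y)
  simpa using h w y

lemma fderiv_integral_slice (f : 𝓢(W × Y, E)) :
    fderiv ℝ (fun w => ∫ y, f (w, y) ∂μ) = fun w => ∫ y, f.fderivFst (w, y) ∂μ :=
  funext fun w => (f.hasFDerivAt_integral_slice μ w).fderiv

/-- The derivative of the integral is the integral of `fderivFst`, again a Schwartz function but
with values in W →L[ℝ] E. The target must therefore vary in the induction. -/
lemma contDiff_integral_slice (m : ℕ) : ∀ {E : Type} [NormedAddCommGroup E] [NormedSpace ℝ E]
    (f : 𝓢(W × Y, E)), ContDiff ℝ m (fun w => ∫ y, f (w, y) ∂μ) := by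
  induction m with
  | zero =>
    intro E _ _ f
    exact contDiff_zero.2 (continuous_iff_continuousAt.2 fun w =>
      (f.hasFDerivAt_integral_slice μ w).continuousAt)
  | succ m ih =>
    intro E _ _ f
    rw [Nat.cast_succ, contDiff_succ_iff_fderiv]
    refine ⟨fun w => (f.hasFDerivAt_integral_slice μ w).differentiableAt, ?_, ?_⟩
    -- The analyticity clause concerns only the smoothness exponent ω, which a natural number never
    -- equals.
    · intro h
      exact absurd h (by simp)
    · rw [fderiv_integral_slice]
      exact ih f.fderivFst

lemma decay_integral_slice (k m : ℕ) : ∀ {E : Type} [NormedAddCommGroup E] [NormedSpace ℝ E]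
    (f : 𝓢(W × Y, E)), ∃ C : ℝ, ∀ w,
      ‖w‖ ^ k * ‖iteratedFDeriv ℝ m (fun w => ∫ y, f (w, y) ∂μ) w‖ ≤ C := by
  induction m with
  | zero =>
    intro E _ _ f
    obtain ⟨B, hB, h⟩ := f.exists_integrable_bound_slice μ k
    refine ⟨∫ y, B y ∂μ, fun w => ?_⟩
    rw [norm_iteratedFDeriv_zero]
    calc ‖w‖ ^ k * ‖∫ y, f (w, y) ∂μ‖ ≤ ‖w‖ ^ k * ∫ y, ‖f (w, y)‖ ∂μ := by
          gcongr
          exact norm_integral_le_integral_norm _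
      _ = ∫ y, ‖w‖ ^ k * ‖f (w, y)‖ ∂μ := (integral_const_mul _ _).symm
      _ ≤ ∫ y, B y ∂μ :=
          integral_mono ((f.integrable_slice μ w).norm.const_mul _) hB (h w)
  | succ m ih =>
    intro E _ _ f
    obtain ⟨C, hC⟩ := ih f.fderivFst
    refine ⟨C, fun w => ?_⟩
    rw [← norm_iteratedFDeriv_fderiv, fderiv_integral_slice]
    exact hC w

/-- Integrating a Schwartz function on a product over the second variable gives a Schwartz
function. -/
def integralSnd (f : 𝓢(W × Y, E)) : 𝓢(W, E) where
  toFun w := ∫ y, f (w, y) ∂μ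
  smooth' := contDiff_infty.2 fun m => contDiff_integral_slice μ m f
  decay' k m := decay_integral_slice μ k m f

lemma integralSnd_apply (f : 𝓢(W × Y, E)) (w : W) :
    f.integralSnd μ w = ∫ y, f (w, y) ∂μ := rfl

lemma fderiv_integralSnd_apply [CompleteSpace E] (f : 𝓢(W × Y, E)) (w v : W) :
    fderiv ℝ (f.integralSnd μ) w v = ∫ y, fderiv ℝ f (w, y) (v, 0) ∂μ := by
  rw [show (f.integralSnd μ : W → E) = fun w => ∫ y, f (w, y) ∂μ from rfl, fderiv_integral_slice,
    ContinuousLinearMap.integral_apply (f.fderivFst.integrable_slice μ w)]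
  rfl

/-- Integration by parts against the constant 1. That constant need not be integrable, since only
its products with the slice and its derivative enter. -/
lemma integral_fderiv_snd [FiniteDimensional ℝ Y] [μ.IsAddHaarMeasure] (f : 𝓢(W × Y, ℂ))
    (w : W) (v : Y) : ∫ y, fderiv ℝ f (w, y) (0, v) ∂μ = 0 := by
  have h1 : Integrable (fun y => fderiv ℝ f (w, y) (0, v)) μ :=
    ((fderivCLM ℝ (W × Y) ℂ f).integrable_slice μ w).apply_continuousLinearMap (0, v)
  have h := integral_bilinear_hasLineDerivAt_right_eq_neg_left_of_integrable (μ := μ)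
    (f := fun _ : Y => (1 : ℂ)) (f' := fun _ => 0) (g := fun y => f (w, y))
    (g' := fun y => fderiv ℝ f (w, y) (0, v)) (v := v) (B := ContinuousLinearMap.mul ℝ ℂ)
    (by simp) (by simpa using h1) (by simpa using f.integrable_slice μ w)
    (fun x _ => by simpa using (hasFDerivAt_const (1 : ℂ) x).hasLineDerivAt v)
    (fun y _ => ((f.hasFDerivAt (w, y)).comp y (hasFDerivAt_prodMk_right w y)).hasLineDerivAt v)
  simpa using h

end PartialIntegral

end SchwartzMap

/-! ### Finite dimensional charts and calculus on R_-^n. -/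

namespace NegLoop

variable {n : ℕ}

lemma mulTInv_apply_zero (x : NegLoop n) : mulTInv x 0 = 0 :=
  Finsupp.mapDomain_of_notMem_range _ _ (by simp)

lemma mulTInv_apply_succ (x : NegLoop n) (k : ℕ) : mulTInv x (k + 1) = x k :=
  Finsupp.mapDomain_apply (add_left_injective 1) x k

lemma mulTInv_single (k : ℕ) (y : Fin n → ℝ) :
    mulTInv (Finsupp.single k y : NegLoop n) = Finsupp.single (k + 1) y :=
  Finsupp.mapDomain_single

/-- Schwartz functions on R_-^n are controlled only along injective charts, so pointwise identities
are checked in a chart whose range contains every vector involved. -/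
lemma exists_chart (W : Submodule ℝ (NegLoop n)) [FiniteDimensional ℝ W] :
    ∃ (N : ℕ) (L : EuclideanSpace ℝ (Fin N) →ₗ[ℝ] NegLoop n),
      Function.Injective L ∧ LinearMap.range L = W := by
  let e : EuclideanSpace ℝ (Fin (Module.finrank ℝ W)) ≃ₗ[ℝ] W :=
    haveI : Module.Free ℝ W := Module.Free.of_divisionRing ℝ W
    LinearEquiv.ofFinrankEq _ _ (by simp)
  refine ⟨_, W.subtype ∘ₗ e.toLinearMap, W.subtype_injective.comp e.injective, ?_⟩
  rw [LinearMap.range_comp, LinearEquiv.range, Submodule.map_top, Submodule.range_subtype]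

/-- A linear chart whose image contains a given finite family of vectors. -/
lemma exists_chart_of_finset (s : Finset (NegLoop n)) :
    ∃ (N : ℕ) (L : EuclideanSpace ℝ (Fin N) →ₗ[ℝ] NegLoop n),
      Function.Injective L ∧ ∀ x ∈ s, ∃ v, L v = x := by
  obtain ⟨N, L, hL, hr⟩ := exists_chart (Submodule.span ℝ (s : Set (NegLoop n)))
  refine ⟨N, L, hL, fun x hx => ?_⟩
  have : x ∈ LinearMap.range L := hr ▸ Submodule.subset_span hx
  exact this

lemma lineDeriv_comp_linear {V : Type*} [NormedAddCommGroup V] [NormedSpace ℝ V]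
    {f : NegLoop n → ℂ} {φ : 𝓢(V, ℂ)} {L : V →ₗ[ℝ] NegLoop n} (h : ∀ v, φ v = f (L v))
    (v w : V) : lineDeriv ℝ f (L v) (L w) = fderiv ℝ φ v w := by
  rw [← φ.differentiableAt.lineDeriv_eq_fderiv]
  simp only [lineDeriv, h, map_add, map_smul]

lemma hasLineDerivAt_comp_linear {V : Type*} [NormedAddCommGroup V] [NormedSpace ℝ V]
    {f : NegLoop n → ℂ} {φ : 𝓢(V, ℂ)} {L : V →ₗ[ℝ] NegLoop n} (h : ∀ v, φ v = f (L v))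
    (v w : V) : HasLineDerivAt ℝ f (fderiv ℝ φ v w) (L v) (L w) := by
  have := (φ.hasFDerivAt v).hasLineDerivAt w
  simpa only [HasLineDerivAt, h, map_add, map_smul] using this

/-- The chart `(v, y) ↦ t⁻¹ v + y t⁻¹` induced by a chart. -/
def fiberChart {V : Type*} [AddCommGroup V] [Module ℝ V] (L : V →ₗ[ℝ] NegLoop n) :
    V × (Fin n → ℝ) →ₗ[ℝ] NegLoop n :=
  (mulTInv ∘ₗ L).coprod (Finsupp.lsingle 0)

lemma fiberChart_apply {V : Type*} [AddCommGroup V] [Module ℝ V]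
    (L : V →ₗ[ℝ] NegLoop n) (v : V) (y : Fin n → ℝ) :
    fiberChart L (v, y) = mulTInv (L v) + Finsupp.single 0 y := rfl

lemma fiberChart_injective {V : Type*} [AddCommGroup V] [Module ℝ V]
    {L : V →ₗ[ℝ] NegLoop n} (hL : Function.Injective L) : Function.Injective (fiberChart L) := by
  rintro ⟨v, y⟩ ⟨v', y'⟩ h
  rw [fiberChart_apply, fiberChart_apply] at h
  have hy : y = y' := by simpa [mulTInv_apply_zero] using DFunLike.congr_fun h 0
  have hv : L v = L v' := by
    ext1 k
    simpa [mulTInv_apply_succ] using DFunLike.congr_fun h (k + 1)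
  rw [hL hv, hy]

namespace IsSchwartz

variable {f g : NegLoop n → ℂ}

/-- Needed for product charts such as `fiberChart`, whose domain is not a Euclidean space; linear
isomorphisms in finite dimension preserve the Schwartz property. -/
lemma exists_schwartzMap (hf : IsSchwartz f) {V : Type*} [NormedAddCommGroup V] [NormedSpace ℝ V]
    [FiniteDimensional ℝ V] (L : V →ₗ[ℝ] NegLoop n) (hL : Function.Injective L) :
    ∃ φ : 𝓢(V, ℂ), ∀ v, φ v = f (L v) := by
  let e : V ≃L[ℝ] EuclideanSpace ℝ (Fin (Module.finrank ℝ V)) := toEuclidean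
  obtain ⟨φ, hφ⟩ := hf _ (L ∘ₗ e.symm.toLinearEquiv.toLinearMap) (hL.comp e.symm.injective)
  refine ⟨SchwartzMap.compCLMOfContinuousLinearEquiv ℝ e φ, fun v => ?_⟩
  simp [hφ]

lemma hasLineDerivAt (hf : IsSchwartz f) (x w : NegLoop n) :
    HasLineDerivAt ℝ f (lineDeriv ℝ f x w) x w := by
  classical
  obtain ⟨N, L, hL, hs⟩ := exists_chart_of_finset {x, w}
  obtain ⟨φ, hφ⟩ := hf N L hL
  obtain ⟨v, rfl⟩ := hs x (by simp)
  obtain ⟨v', rfl⟩ := hs w (by simp)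
  exact (hasLineDerivAt_comp_linear hφ v v').lineDifferentiableAt.hasLineDerivAt

lemma lineDeriv_add (hf : IsSchwartz f) (x w w' : NegLoop n) :
    lineDeriv ℝ f x (w + w') = lineDeriv ℝ f x w + lineDeriv ℝ f x w' := by
  classical
  obtain ⟨N, L, hL, hs⟩ := exists_chart_of_finset {x, w, w'}
  obtain ⟨φ, hφ⟩ := hf N L hL
  obtain ⟨v, rfl⟩ := hs x (by simp)
  obtain ⟨v₁, rfl⟩ := hs w (by simp)
  obtain ⟨v₂, rfl⟩ := hs w' (by simp)
  rw [← map_add, lineDeriv_comp_linear hφ, lineDeriv_comp_linear hφ, lineDeriv_comp_linear hφ,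
    map_add]

/-- The differential at a point of a Schwartz function on `R_-^n`. -/
def differential (hf : IsSchwartz f) (x : NegLoop n) : NegLoop n →ₗ[ℝ] ℂ where
  toFun := lineDeriv ℝ f x
  map_add' := hf.lineDeriv_add x
  map_smul' _ _ := lineDeriv_smul

lemma differential_apply (hf : IsSchwartz f) (x w : NegLoop n) :
    hf.differential x w = lineDeriv ℝ f x w := rfl

/-- Differentiating a Schwartz function along an affine vector field gives a Schwartz function. -/
lemma lineDeriv_affine (hf : IsSchwartz f) (T : NegLoop n →ₗ[ℝ] NegLoop n) (c : NegLoop n) :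
    IsSchwartz fun x => lineDeriv ℝ f x (T x + c) := by
  intro N L hL
  -- The field need not be tangent to the range of `L`, so the derivative is taken in a larger chart
  -- containing that range, its image under `T`, and `c`.
  obtain ⟨M, A, hA, hr⟩ := exists_chart
    (LinearMap.range L ⊔ LinearMap.range (T ∘ₗ L) ⊔ Submodule.span ℝ {c})
  obtain ⟨φ, hφ⟩ := hf M A hA
  have lift (B : EuclideanSpace ℝ (Fin N) →ₗ[ℝ] NegLoop n)
      (hB : LinearMap.range B ≤ LinearMap.range A) :
      ∃ B' : EuclideanSpace ℝ (Fin N) →ₗ[ℝ] EuclideanSpace ℝ (Fin M), ∀ v, A (B' v) = B v := by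
    refine ⟨(LinearEquiv.ofInjective A hA).symm.toLinearMap ∘ₗ
      B.codRestrict (LinearMap.range A) fun v => hB ⟨v, rfl⟩, fun v => ?_⟩
    have := (LinearEquiv.ofInjective A hA).apply_symm_apply
      (B.codRestrict (LinearMap.range A) (fun v => hB ⟨v, rfl⟩) v)
    exact congrArg Subtype.val this
  obtain ⟨L', hL'⟩ := lift L (hr ▸ le_sup_of_le_left le_sup_left)
  obtain ⟨T', hT'⟩ := lift (T ∘ₗ L) (hr ▸ le_sup_of_le_left le_sup_right)
  obtain ⟨c', hc'⟩ : ∃ c', A c' = c := by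
    have : c ∈ LinearMap.range A :=
      hr ▸ Submodule.mem_sup_right (Submodule.mem_span_singleton_self c)
    exact this
  have hinj : Function.Injective L' := fun v w h => hL <| by rw [← hL', h, hL']
  -- Pulling back along `L'` preserves decay because an injective linear map in finite dimension is
  -- bounded below. The affine field `T' v + c'` costs only temperate growth.
  obtain ⟨K, -, hK⟩ := L'.injective_iff_antilipschitz.mp hinj
  have hg : (fun v => T' v + c').HasTemperateGrowth :=
    (LinearMap.toContinuousLinearMap T').hasTemperateGrowth.add (.const c')
  refine ⟨SchwartzMap.bilinLeftCLM
    (ContinuousLinearMap.id ℝ (EuclideanSpace ℝ (Fin M) →L[ℝ] ℂ)) hg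
    (SchwartzMap.compCLMOfAntilipschitz ℝ
      (LinearMap.toContinuousLinearMap L').hasTemperateGrowth hK
      (SchwartzMap.fderivCLM ℝ _ ℂ φ)), fun v => ?_⟩
  have hA' : T (L v) + c = A (T' v + c') := by rw [map_add, hT', hc']; rfl
  beta_reduce
  rw [hA', ← hL' v, lineDeriv_comp_linear hφ]
  rfl

lemma lineDeriv_linear (hf : IsSchwartz f) (T : NegLoop n →ₗ[ℝ] NegLoop n) :
    IsSchwartz fun x => lineDeriv ℝ f x (T x) := by
  simpa using hf.lineDeriv_affine T 0

lemma lineDeriv_const (hf : IsSchwartz f) (w : NegLoop n) :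
    IsSchwartz fun x => lineDeriv ℝ f x w := by
  simpa using hf.lineDeriv_affine 0 w

lemma linear_mul (hf : IsSchwartz f) (ℓ : NegLoop n →ₗ[ℝ] ℝ) :
    IsSchwartz fun x => (ℓ x : ℂ) * f x := by
  intro N L hL
  obtain ⟨φ, hφ⟩ := hf N L hL
  have hg : (fun v => (ℓ (L v) : ℂ)).HasTemperateGrowth :=
    Function.HasTemperateGrowth.comp Function.Complex.hasTemperateGrowth_ofReal
      (LinearMap.toContinuousLinearMap (ℓ ∘ₗ L)).hasTemperateGrowth
  refine ⟨SchwartzMap.smulLeftCLM ℂ (fun v => (ℓ (L v) : ℂ)) φ, fun v => ?_⟩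
  rw [SchwartzMap.smulLeftCLM_apply_apply hg, hφ, smul_eq_mul]

lemma exists_fiber (hf : IsSchwartz f) {V : Type*} [NormedAddCommGroup V] [NormedSpace ℝ V]
    [FiniteDimensional ℝ V] {L : V →ₗ[ℝ] NegLoop n} (hL : Function.Injective L) :
    ∃ φ : 𝓢(V × (Fin n → ℝ), ℂ), ∀ p, φ p = f (fiberChart L p) :=
  hf.exists_schwartzMap _ (fiberChart_injective hL)

lemma piT (hf : IsSchwartz f) : IsSchwartz (NegLoop.piT f) := by
  intro N L hL
  obtain ⟨φ, hφ⟩ := hf.exists_fiber hL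
  refine ⟨φ.integralSnd volume, fun v => ?_⟩
  simp only [SchwartzMap.integralSnd_apply, hφ]
  rfl

/-- Differentiation under the integral sign: `π_t ∂_{t⁻¹ w} = ∂_w π_t`. -/
lemma integral_lineDeriv_mulTInv (hf : IsSchwartz f) (x w : NegLoop n) :
    ∫ y, lineDeriv ℝ f (mulTInv x + Finsupp.single 0 y) (mulTInv w) =
      lineDeriv ℝ (NegLoop.piT f) x w := by
  classical
  obtain ⟨N, L, hL, hs⟩ := exists_chart_of_finset {x, w}
  obtain ⟨φ, hφ⟩ := hf.exists_fiber hL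
  obtain ⟨v, rfl⟩ := hs x (by simp)
  obtain ⟨u, rfl⟩ := hs w (by simp)
  have hπ : ∀ v, φ.integralSnd volume v = NegLoop.piT f (L v) := fun v => by
    simp only [SchwartzMap.integralSnd_apply, hφ]
    rfl
  rw [lineDeriv_comp_linear hπ, SchwartzMap.fderiv_integralSnd_apply]
  refine integral_congr_ae (Filter.Eventually.of_forall fun y => ?_)
  have := lineDeriv_comp_linear hφ (v, y) (u, 0)
  rwa [fiberChart_apply, fiberChart_apply, Finsupp.single_zero, add_zero] at this

/-- The integral over the fibre of a derivative along the fibre vanishes. -/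
lemma integral_lineDeriv_single (hf : IsSchwartz f) (x : NegLoop n) (z : Fin n → ℝ) :
    ∫ y, lineDeriv ℝ f (mulTInv x + Finsupp.single 0 y) (Finsupp.single 0 z) = 0 := by
  classical
  obtain ⟨N, L, hL, hs⟩ := exists_chart_of_finset {x}
  obtain ⟨φ, hφ⟩ := hf.exists_fiber hL
  obtain ⟨v, rfl⟩ := hs x (by simp)
  rw [← φ.integral_fderiv_snd volume v z]
  refine integral_congr_ae (Filter.Eventually.of_forall fun y => ?_)
  have := lineDeriv_comp_linear hφ (v, y) (0, z)
  rwa [fiberChart_apply, fiberChart_apply, map_zero, map_zero, zero_add] at this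

/-- The commutator of differentiations along linear vector fields. -/
lemma lineDeriv_linear_comm (hf : IsSchwartz f) (S T : NegLoop n →ₗ[ℝ] NegLoop n)
    (x : NegLoop n) :
    lineDeriv ℝ (fun x => lineDeriv ℝ f x (T x)) x (S x) -
      lineDeriv ℝ (fun x => lineDeriv ℝ f x (S x)) x (T x) =
      lineDeriv ℝ f x (T (S x) - S (T x)) := by
  classical
  obtain ⟨N, L, hL, hs⟩ := exists_chart_of_finset {x, S x, T x, S (T x), T (S x)}
  obtain ⟨φ, hφ⟩ := hf N L hL
  obtain ⟨v, hv⟩ := hs x (by simp)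
  obtain ⟨s, hs1⟩ := hs (S x) (by simp)
  obtain ⟨t, ht1⟩ := hs (T x) (by simp)
  obtain ⟨st, hst⟩ := hs (S (T x)) (by simp)
  obtain ⟨ts, hts⟩ := hs (T (S x)) (by simp)
  -- The product rule gives a Hessian term plus the derivative along B(Ax). The Hessian terms cancel
  -- by symmetry in the commutator, leaving a first order operator.
  have key (A B : NegLoop n →ₗ[ℝ] NegLoop n) (a b ba : EuclideanSpace ℝ (Fin N))
      (ha : L a = A x) (hb : L b = B x) (hba : L ba = B (A x)) :
      lineDeriv ℝ (fun x => lineDeriv ℝ f x (B x)) x (A x) =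
        fderiv ℝ (fderiv ℝ φ) v a b + fderiv ℝ φ v ba := by
    have h1 : ∀ r : ℝ, lineDeriv ℝ f (x + r • A x) (B (x + r • A x)) =
        fderiv ℝ φ (v + r • a) (b + r • ba) := fun r => by
      rw [← lineDeriv_comp_linear hφ]
      simp only [map_add, map_smul, hv, ha, hb, hba]
    have h2 : HasDerivAt (fun r : ℝ => fderiv ℝ φ (v + r • a)) (fderiv ℝ (fderiv ℝ φ) v a) 0 :=
      ((SchwartzMap.fderivCLM ℝ _ ℂ φ).hasFDerivAt v).hasLineDerivAt a
    have h3 : HasDerivAt (fun r : ℝ => b + r • ba) ba 0 := by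
      simpa using ((hasDerivAt_id (0 : ℝ)).smul_const ba).const_add b
    have h4 := h2.clm_apply h3
    simp only [zero_smul, add_zero] at h4
    rw [lineDeriv]
    simp only [h1]
    exact h4.deriv
  have hsymm : fderiv ℝ (fderiv ℝ φ) v s t = fderiv ℝ (fderiv ℝ φ) v t s :=
    ((φ.contDiffAt 2 (x := v)).isSymmSndFDerivAt (by simp)) s t
  rw [key S T s t ts hs1 ht1 hts, key T S t s st ht1 hs1 hst, hsymm, add_sub_add_left_eq_sub,
    ← map_sub, ← lineDeriv_comp_linear hφ, map_sub, hv, hst, hts]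

lemma lineDeriv_linear_mul (hf : IsSchwartz f) (ℓ : NegLoop n →ₗ[ℝ] ℝ) (x w : NegLoop n) :
    lineDeriv ℝ (fun x => (ℓ x : ℂ) * f x) x w = ℓ w * f x + ℓ x * lineDeriv ℝ f x w := by
  have h1 : HasDerivAt (fun r : ℝ => ((ℓ (x + r • w) : ℝ) : ℂ)) (ℓ w : ℂ) 0 := by
    simp only [map_add, map_smul, smul_eq_mul]
    have : HasDerivAt (fun r : ℝ => ℓ x + r * ℓ w) (ℓ w) 0 := by
      simpa using ((hasDerivAt_id (0 : ℝ)).mul_const (ℓ w)).const_add (ℓ x)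
    exact this.ofReal_comp
  have h := h1.mul (hf.hasLineDerivAt x w)
  simp only [zero_smul, add_zero] at h
  exact h.deriv

lemma lineDeriv_fun_add (hf : IsSchwartz f) (hg : IsSchwartz g) (x w : NegLoop n) :
    lineDeriv ℝ (f + g) x w = lineDeriv ℝ f x w + lineDeriv ℝ g x w :=
  (HasDerivAt.add (hf.hasLineDerivAt x w) (hg.hasLineDerivAt x w)).deriv

lemma lineDeriv_fun_smul (hf : IsSchwartz f) (c : ℂ) (x w : NegLoop n) :
    lineDeriv ℝ (c • f) x w = c • lineDeriv ℝ f x w := by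
  have h := HasDerivAt.const_smul c (hf.hasLineDerivAt x w)
  exact h.deriv

end IsSchwartz

end NegLoop

/-! ### Truncated matrix modes on R_-^n and their composition defect. -/

namespace NegLoop

variable {n : ℕ}

/-- The coordinate `x_{-(i+1)}^v`, extended by zero to negative `i`. -/
def coeff (i : ℤ) (v : Fin n) : NegLoop n →ₗ[ℝ] ℝ :=
  if 0 ≤ i then LinearMap.proj v ∘ₗ Finsupp.lapply i.toNat else 0

lemma coeff_apply (i : ℤ) (v : Fin n) (x : NegLoop n) :
    coeff i v x = if 0 ≤ i then x i.toNat v else 0 := by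
  unfold coeff
  split_ifs <;> simp

lemma basisVec_apply (k l : ℕ) (u w : Fin n) :
    basisVec k u l w = if l = k ∧ w = u then 1 else 0 := by
  unfold basisVec
  by_cases hk : l = k
  · subst hk
    simp [Pi.single_apply]
  · rw [Finsupp.single_eq_of_ne hk]
    simp [hk]

lemma coeff_basisVec (i : ℤ) (v : Fin n) (k : ℕ) (u : Fin n) :
    coeff i v (basisVec k u) = if i = k ∧ v = u then 1 else 0 := by
  rw [coeff_apply, basisVec_apply]
  by_cases hi : 0 ≤ i
  · obtain ⟨l, rfl⟩ := Int.eq_ofNat_of_zero_le hi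
    simp
  · rw [if_neg hi, if_neg (by omega)]

/-- The truncation to `R_-^n` of the operator `E_{uv} t^m`. -/
def unitMode (m : ℤ) (u v : Fin n) : NegLoop n →ₗ[ℝ] NegLoop n :=
  Finsupp.lsum ℝ fun k : ℕ => if 0 ≤ (k : ℤ) - m then
    Finsupp.lsingle ((k : ℤ) - m).toNat ∘ₗ LinearMap.single ℝ (fun _ => ℝ) u ∘ₗ LinearMap.proj v
    else 0

lemma unitMode_single (m : ℤ) (u v : Fin n) (k : ℕ) (y : Fin n → ℝ) :
    unitMode m u v (Finsupp.single k y) =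
      if 0 ≤ (k : ℤ) - m then y v • basisVec ((k : ℤ) - m).toNat u else 0 := by
  rw [unitMode, Finsupp.lsum_single]
  split_ifs
  · simp [basisVec, ← Pi.single_smul]
  · simp

lemma unitMode_apply (m : ℤ) (u v : Fin n) (x : NegLoop n) (k : ℕ) (w : Fin n) :
    unitMode m u v x k w = if w = u then coeff (k + m) v x else 0 := by
  induction x using Finsupp.induction_linear with
  | zero => simp
  | add x y hx hy =>
    rw [map_add, map_add, Finsupp.add_apply, Pi.add_apply, hx, hy]
    split_ifs <;> simp
  | single l y =>
    rw [unitMode_single, coeff_apply]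
    by_cases h : (k : ℤ) + m = l
    · rw [if_pos (show 0 ≤ (l : ℤ) - m by omega), if_pos (show 0 ≤ (k : ℤ) + m by omega), h]
      have h' : ((l : ℤ) - m).toNat = k := by omega
      simp only [h', Int.toNat_natCast, Finsupp.smul_apply, Pi.smul_apply, basisVec_apply, true_and,
        Finsupp.single_eq_same, smul_eq_mul, mul_ite, mul_one, mul_zero]
    · have h1 : (if 0 ≤ (k : ℤ) + m then (Finsupp.single l y : NegLoop n) ((k : ℤ) + m).toNat v
          else 0) = 0 := by
        split_ifs
        · rw [Finsupp.single_eq_of_ne (by omega), Pi.zero_apply]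
        · rfl
      rw [h1, ite_self]
      split_ifs with h2
      · rw [Finsupp.smul_apply, Pi.smul_apply, basisVec_apply,
          if_neg (fun h3 => by have := h3.1; omega), smul_zero]
      · rfl

lemma coeff_unitMode (i m : ℤ) (u v w : Fin n) (x : NegLoop n) :
    coeff i w (unitMode m u v x) = if 0 ≤ i ∧ w = u then coeff (i + m) v x else 0 := by
  rw [coeff_apply, unitMode_apply]
  by_cases hi : 0 ≤ i
  · simp [hi]
  · simp [hi]

/-- For negative m the outer map shifts away from the first -m coefficients and leaves them empty,
while `unitMode (m + p)` may fill them. The sum removes exactly these entries; for m ≥ 0 it is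
empty. -/
lemma unitMode_comp (m p : ℤ) (u v u' v' : Fin n) :
    unitMode m u v ∘ₗ unitMode p u' v' = if v = u' then unitMode (m + p) u v' -
      ∑ k ∈ Finset.range (-m).toNat, (coeff (k + (m + p)) v').smulRight (basisVec k u) else 0 := by
  refine LinearMap.ext fun x => Finsupp.ext fun k => funext fun w => ?_
  rw [LinearMap.comp_apply, unitMode_apply, coeff_unitMode]
  by_cases hv : v = u'
  · by_cases hw : w = u
    · simp only [hv, hw, if_true, LinearMap.sub_apply, LinearMap.sum_apply, Finsupp.sub_apply,
        Pi.sub_apply, Finsupp.finsetSum_apply, Finset.sum_apply, LinearMap.smulRight_apply,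
        Finsupp.smul_apply, Pi.smul_apply, basisVec_apply, unitMode_apply, smul_eq_mul, mul_ite,
        mul_one, mul_zero, and_true, Finset.sum_ite_eq, Finset.mem_range, add_assoc]
      by_cases hk : 0 ≤ (k : ℤ) + m
      · rw [if_pos hk, if_neg (by omega), sub_zero]
      · rw [if_neg hk, if_pos (by omega), sub_self]
    · simp [hv, hw, unitMode_apply, basisVec_apply]
  · simp [hv]

/-- The mode commutes with multiplication by t⁻¹ except in the single coefficient (-m)^+. For m < 0
that entry is where y lands; for m ≥ 0 it is the entry that truncation would have dropped before the
shift. Without it, the field on the fibre over x is the lift of the field at x. -/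
lemma unitMode_sub_smulRight_mulTInv (m : ℤ) (u v : Fin n) (x : NegLoop n) (y : Fin n → ℝ) :
    (unitMode m u v - (coeff ((-m).toNat + m) v).smulRight (basisVec (-m).toNat u))
      (mulTInv x + Finsupp.single 0 y) = mulTInv (unitMode m u v x) := by
  refine Finsupp.ext fun k => funext fun w => ?_
  rw [LinearMap.sub_apply, Finsupp.sub_apply, Pi.sub_apply, LinearMap.smulRight_apply,
    Finsupp.smul_apply, Pi.smul_apply, basisVec_apply, unitMode_apply, smul_eq_mul]
  by_cases hw : w = u
  swap
  · cases k <;> simp [hw, mulTInv_apply_zero, mulTInv_apply_succ, unitMode_apply]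
  by_cases hk : k = (-m).toNat
  · subst hk
    simp only [hw, and_self, if_true, mul_one, sub_self]
    rcases hm : (-m).toNat with _ | j
    · rw [mulTInv_apply_zero, Pi.zero_apply]
    · rw [mulTInv_apply_succ, unitMode_apply, if_pos rfl, coeff_apply, if_neg (by omega)]
  · rw [if_pos hw, if_neg (by simp [hk]), mul_zero, sub_zero, coeff_apply]
    rcases k with _ | k
    · rw [if_neg (by omega), mulTInv_apply_zero, Pi.zero_apply]
    · rw [mulTInv_apply_succ, unitMode_apply, if_pos hw, coeff_apply]
      by_cases h0 : 0 ≤ (k : ℤ) + m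
      · have h1 : (((k + 1 : ℕ) : ℤ) + m).toNat = ((k : ℤ) + m).toNat + 1 := by omega
        rw [if_pos h0, if_pos (by omega), h1, Finsupp.add_apply, mulTInv_apply_succ,
          Finsupp.single_eq_of_ne (by omega), add_zero]
      · rw [if_neg h0, if_neg (by omega)]

/-! ### Operator identities modulo powers of π_t. -/

/-- The space `S(R_-^n)` as a type. -/
def SchwartzFn (n : ℕ) : Type := schwartzSpace n

instance : AddCommGroup (SchwartzFn n) := inferInstanceAs (AddCommGroup (schwartzSpace n))

instance : Module ℂ (SchwartzFn n) := inferInstanceAs (Module ℂ (schwartzSpace n))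

/-- The operator `π_t` on Schwartz functions. -/
def piTEnd (n : ℕ) : Module.End ℂ (SchwartzFn n) where
  toFun f := ⟨piT f.1, IsSchwartz.piT f.2⟩
  map_add' f g := Subtype.ext <| funext fun x =>
    integral_add (IsSchwartz.integrable_piT f.2 x) (IsSchwartz.integrable_piT g.2 x)
  map_smul' c _ := Subtype.ext <| funext fun _ => integral_const_mul c _

lemma piTEnd_pow_coe (j : ℕ) (f : SchwartzFn n) :
    ((piTEnd n ^ j) f).1 = piT^[j] f.1 := by
  induction j with
  | zero => rfl
  | succ j ih =>
    rw [pow_succ', Function.iterate_succ_apply', ← ih]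
    rfl

/-- Differentiation along a linear vector field, as an operator on Schwartz functions. -/
def fieldDeriv : (NegLoop n →ₗ[ℝ] NegLoop n) →+ Module.End ℂ (SchwartzFn n) where
  toFun T :=
    { toFun := fun f => ⟨fun x => lineDeriv ℝ f.1 x (T x), IsSchwartz.lineDeriv_linear f.2 T⟩
      map_add' := fun f g => Subtype.ext <| funext fun x =>
        IsSchwartz.lineDeriv_fun_add f.2 g.2 x (T x)
      map_smul' := fun c f => Subtype.ext <| funext fun x =>
        IsSchwartz.lineDeriv_fun_smul f.2 c x (T x) }
  map_zero' := LinearMap.ext fun _ => Subtype.ext <| funext fun _ => lineDeriv_zero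
  map_add' S T := LinearMap.ext fun f => Subtype.ext <| funext fun x =>
    IsSchwartz.lineDeriv_add f.2 x (S x) (T x)

lemma fieldDeriv_apply (T : NegLoop n →ₗ[ℝ] NegLoop n) (f : SchwartzFn n) (x : NegLoop n) :
    (fieldDeriv T f).1 x = lineDeriv ℝ f.1 x (T x) := rfl

/-- Differentiation along a constant vector, as an operator on Schwartz functions. -/
def constDeriv (w : NegLoop n) : Module.End ℂ (SchwartzFn n) where
  toFun f := ⟨fun x => lineDeriv ℝ f.1 x w, IsSchwartz.lineDeriv_const f.2 w⟩
  map_add' f g := Subtype.ext <| funext fun x => IsSchwartz.lineDeriv_fun_add f.2 g.2 x w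
  map_smul' c f := Subtype.ext <| funext fun x => IsSchwartz.lineDeriv_fun_smul f.2 c x w

/-- Multiplication by a linear form, as an operator on Schwartz functions. -/
def linearMul (ℓ : NegLoop n →ₗ[ℝ] ℝ) : Module.End ℂ (SchwartzFn n) where
  toFun f := ⟨fun x => (ℓ x : ℂ) * f.1 x, IsSchwartz.linear_mul f.2 ℓ⟩
  map_add' _ _ := Subtype.ext <| funext fun _ => mul_add _ _ _
  map_smul' _ _ := Subtype.ext <| funext fun _ => mul_left_comm _ _ _

lemma fieldDeriv_sub (S T : NegLoop n →ₗ[ℝ] NegLoop n) :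
    fieldDeriv (S - T) = fieldDeriv S - fieldDeriv T :=
  map_sub fieldDeriv S T

lemma fieldDeriv_comm (S T : NegLoop n →ₗ[ℝ] NegLoop n) :
    fieldDeriv S * fieldDeriv T - fieldDeriv T * fieldDeriv S =
      fieldDeriv (T ∘ₗ S) - fieldDeriv (S ∘ₗ T) := by
  rw [← fieldDeriv_sub]
  exact LinearMap.ext fun f => Subtype.ext <| funext fun x =>
    IsSchwartz.lineDeriv_linear_comm f.2 S T x

/-- The Leibniz rule, arranged with the constant derivative outermost so that fibre integration can
annihilate it. -/
lemma fieldDeriv_smulRight (ℓ : NegLoop n →ₗ[ℝ] ℝ) (w : NegLoop n) :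
    fieldDeriv (ℓ.smulRight w) = constDeriv w * linearMul ℓ - (ℓ w : ℂ) • 1 := by
  refine LinearMap.ext fun f => Subtype.ext <| funext fun x => ?_
  have h : lineDeriv ℝ f.1 x (ℓ x • w) =
      lineDeriv ℝ (fun x => (ℓ x : ℂ) * f.1 x) x w -
        ℓ w * f.1 x := by
    rw [IsSchwartz.lineDeriv_linear_mul f.2, lineDeriv_smul, Complex.real_smul]
    ring
  exact h

lemma piTEnd_mul_constDeriv_mulTInv (w : NegLoop n) :
    piTEnd n * constDeriv (mulTInv w) = constDeriv w * piTEnd n :=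
  LinearMap.ext fun f => Subtype.ext <| funext fun x =>
    IsSchwartz.integral_lineDeriv_mulTInv f.2 x w

lemma piTEnd_mul_constDeriv_single (z : Fin n → ℝ) :
    piTEnd n * constDeriv (Finsupp.single 0 z) = 0 :=
  LinearMap.ext fun f => Subtype.ext <| funext fun x =>
    IsSchwartz.integral_lineDeriv_single f.2 x z

/-- Each π_t moved past the derivative lowers its index by one. After k steps the derivative is
along the fibre, and one more integration kills it; hence the strict inequality. -/
lemma piTEnd_pow_mul_constDeriv {q k : ℕ} (hk : k < q) (u : Fin n) :
    piTEnd n ^ q * constDeriv (basisVec k u) = 0 := by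
  induction q generalizing k with
  | zero => omega
  | succ q ih =>
    rw [pow_succ, mul_assoc]
    rcases k with _ | k
    · rw [basisVec, piTEnd_mul_constDeriv_single, mul_zero]
    · rw [basisVec, ← mulTInv_single, piTEnd_mul_constDeriv_mulTInv, ← mul_assoc,
        ← basisVec, ih (by omega), zero_mul]

lemma piTEnd_pow_mul_fieldDeriv_smulRight {q k : ℕ} (hk : k < q) (u : Fin n)
    (ℓ : NegLoop n →ₗ[ℝ] ℝ) :
    piTEnd n ^ q * fieldDeriv (ℓ.smulRight (basisVec k u)) =
      -(ℓ (basisVec k u) : ℂ) • piTEnd n ^ q := by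
  rw [fieldDeriv_smulRight, mul_sub, ← mul_assoc, piTEnd_pow_mul_constDeriv hk, zero_mul, zero_sub,
    mul_smul_comm, mul_one, neg_smul]

/-- The hypothesis says that `R` lifts `T` with no fibre component, so this is differentiation under
the integral sign. -/
lemma piTEnd_mul_fieldDeriv {R T : NegLoop n →ₗ[ℝ] NegLoop n}
    (h : ∀ x y, R (mulTInv x + Finsupp.single 0 y) = mulTInv (T x)) :
    piTEnd n * fieldDeriv R = fieldDeriv T * piTEnd n := by
  refine LinearMap.ext fun f => Subtype.ext <| funext fun x => ?_
  refine Eq.trans ?_ (IsSchwartz.integral_lineDeriv_mulTInv f.2 x (T x))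
  change ∫ y, lineDeriv ℝ f.1 (mulTInv x + Finsupp.single 0 y) (R _) = _
  simp only [h]

/-- Differentiation along the linear vector field of `a t^m` for a complex matrix `a`. -/
def modeDeriv (m : ℤ) : Matrix (Fin n) (Fin n) ℂ →ₗ[ℂ] Module.End ℂ (SchwartzFn n) where
  toFun a := ∑ u, ∑ v, a u v • fieldDeriv (unitMode m u v)
  map_add' a b := by simp only [Matrix.add_apply, add_smul, Finset.sum_add_distrib]
  map_smul' c a := by
    simp only [Matrix.smul_apply, smul_eq_mul, mul_smul, Finset.smul_sum, RingHom.id_apply]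

lemma modeDeriv_apply (m : ℤ) (a : Matrix (Fin n) (Fin n) ℂ) :
    modeDeriv m a = ∑ u, ∑ v, a u v • fieldDeriv (unitMode m u v) := rfl

lemma modeDeriv_single (m : ℤ) (u v : Fin n) (c : ℂ) :
    modeDeriv m (Matrix.single u v c) = c • fieldDeriv (unitMode m u v) := by
  rw [modeDeriv_apply, Finset.sum_eq_single u, Finset.sum_eq_single v]
  · simp
  · intro v' _ hv
    simp [Matrix.single_apply_of_col_ne u u hv.symm]
  · simp
  · intro u' _ hu
    exact Finset.sum_eq_zero fun v' _ => by simp [Matrix.single_apply_of_row_ne hu.symm]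
  · simp

/-- Each of the (-m)^+ defect fields becomes the same scalar under π_t^q: its linear form is nonzero
on its own direction only if m + p = 0 and the outer matrix indices agree. This is the trace term.
-/
lemma piTEnd_pow_mul_fieldDeriv_comp {m p : ℤ} {q : ℕ} (hq : (-m).toNat ≤ q)
    (u v u' v' : Fin n) :
    piTEnd n ^ q * fieldDeriv (unitMode m u v ∘ₗ unitMode p u' v') =
      piTEnd n ^ q * modeDeriv (m + p) (Matrix.single u v 1 * Matrix.single u' v' 1) +
      (if m + p = 0 then ((-m).toNat : ℂ) * (Matrix.single u v (1 : ℂ) *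
        Matrix.single u' v' 1).trace else 0) • piTEnd n ^ q := by
  rw [unitMode_comp]
  by_cases hv : v = u'
  swap
  · simp [hv, Matrix.single_mul_single_of_ne]
  subst hv
  rw [if_pos rfl, fieldDeriv_sub, map_sum, mul_sub, Finset.mul_sum, Matrix.single_mul_single_same,
    mul_one, modeDeriv_single, one_smul, sub_eq_add_neg, ← Finset.sum_neg_distrib]
  congr 1
  have h : ∀ k ∈ Finset.range (-m).toNat, -(piTEnd n ^ q *
      fieldDeriv ((coeff (k + (m + p)) v').smulRight (basisVec k u))) =
      (if m + p = 0 ∧ v' = u then (1 : ℂ) else 0) • piTEnd n ^ q := fun k hk => by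
    rw [piTEnd_pow_mul_fieldDeriv_smulRight ((Finset.mem_range.1 hk).trans_le hq), ← neg_smul,
      neg_neg, coeff_basisVec]
    congr 1
    simp only [add_eq_left]
    split_ifs <;> simp
  rw [Finset.sum_congr rfl h, Finset.sum_const, Finset.card_range, ← Nat.cast_smul_eq_nsmul ℂ,
    smul_smul]
  congr 1
  by_cases hmp : m + p = 0
  · by_cases hu : u = v'
    · simp [hmp, hu]
    · simp [hmp, hu, Ne.symm hu, Matrix.trace_single_eq_of_ne]
  · simp [hmp]

/-- The commutator of the operators attached to two modes, after enough fibre integrations. -/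
lemma piTEnd_pow_mul_modeDeriv_comm {m p : ℤ} {q : ℕ} (hm : (-m).toNat ≤ q) (hp : (-p).toNat ≤ q)
    (a b : Matrix (Fin n) (Fin n) ℂ) :
    piTEnd n ^ q * (modeDeriv m a * modeDeriv p b - modeDeriv p b * modeDeriv m a) =
      -(piTEnd n ^ q * modeDeriv (m + p) (a * b - b * a)) +
      (if m + p = 0 then (m : ℂ) * (a * b).trace else 0) • piTEnd n ^ q := by
  induction a using Matrix.induction_on' with
  | h_zero => simp
  | h_add a a' ha ha' =>
    have e : (a + a') * b - b * (a + a') = (a * b - b * a) + (a' * b - b * a') := by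
      rw [add_mul, mul_add]; abel
    have e' : (if m + p = 0 then (m : ℂ) * ((a + a') * b).trace else 0) =
        (if m + p = 0 then (m : ℂ) * (a * b).trace else 0) +
        (if m + p = 0 then (m : ℂ) * (a' * b).trace else 0) := by
      split_ifs
      · rw [add_mul, Matrix.trace_add, mul_add]
      · rw [add_zero]
    rw [e, e', map_add, map_add, add_smul, mul_add _ (modeDeriv (m + p) _), neg_add,
      add_add_add_comm, ← ha, ← ha',
      ← mul_add]
    congr 1
    rw [add_mul, mul_add]
    abel
  | h_std_basis u v c =>
    induction b using Matrix.induction_on' with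
    | h_zero => simp
    | h_add b b' hb hb' =>
      have e : Matrix.single u v c * (b + b') - (b + b') * Matrix.single u v c =
          (Matrix.single u v c * b - b * Matrix.single u v c) +
          (Matrix.single u v c * b' - b' * Matrix.single u v c) := by
        rw [add_mul, mul_add]; abel
      have e' : (if m + p = 0 then (m : ℂ) * (Matrix.single u v c * (b + b')).trace else 0) =
          (if m + p = 0 then (m : ℂ) * (Matrix.single u v c * b).trace else 0) +
          (if m + p = 0 then (m : ℂ) * (Matrix.single u v c * b').trace else 0) := by
        split_ifs
        · rw [mul_add, Matrix.trace_add, mul_add]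
        · rw [add_zero]
      rw [e, e', map_add, map_add, add_smul, mul_add _ (modeDeriv (m + p) _), neg_add,
        add_add_add_comm, ← hb, ← hb',
        ← mul_add]
      congr 1
      rw [add_mul, mul_add]
      abel
    | h_std_basis u' v' d =>
      have hc : Matrix.single u v c = c • Matrix.single u v (1 : ℂ) := by simp
      have hd : Matrix.single u' v' d = d • Matrix.single u' v' (1 : ℂ) := by simp
      have h1 := piTEnd_pow_mul_fieldDeriv_comp (p := p) hm u v u' v'
      have h2 := piTEnd_pow_mul_fieldDeriv_comp (p := m) hp u' v' u v
      have h3 : piTEnd n ^ q * (modeDeriv m (Matrix.single u v 1) *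
          modeDeriv p (Matrix.single u' v' 1) - modeDeriv p (Matrix.single u' v' 1) *
          modeDeriv m (Matrix.single u v 1)) =
          -(piTEnd n ^ q * modeDeriv (m + p) (Matrix.single u v 1 * Matrix.single u' v' 1 -
            Matrix.single u' v' 1 * Matrix.single u v 1)) +
          (if m + p = 0 then (m : ℂ) * (Matrix.single u v (1 : ℂ) *
            Matrix.single u' v' 1).trace else 0) • piTEnd n ^ q := by
        rw [modeDeriv_single, modeDeriv_single, one_smul, one_smul, fieldDeriv_comm, mul_sub, h1,
          h2, map_sub, mul_sub, add_comm p m, Matrix.trace_mul_comm (Matrix.single u' v' (1 : ℂ))]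
        by_cases hmp : m + p = 0
        -- With p = -m, one of the two truncated parts is zero and the other is |m|. The asymmetry
        -- of the two defect counts produces the central charge.
        · have e : (m : ℂ) = ((-p).toNat : ℂ) - ((-m).toNat : ℂ) := by
            have : m = ((-p).toNat : ℤ) - ((-m).toNat : ℤ) := by omega
            exact_mod_cast this
          simp only [if_pos hmp]
          rw [e, sub_mul, sub_smul]
          abel
        · simp only [if_neg hmp, zero_smul, add_zero]
          abel
      rw [hc, hd]
      generalize Matrix.single u v (1 : ℂ) = A at *
      generalize Matrix.single u' v' (1 : ℂ) = B at *
      have e : (c • A) * (d • B) - (d • B) * (c • A) = (c * d) • (A * B - B * A) := by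
        simp only [smul_mul_smul_comm, smul_sub, mul_comm d c]
      have e' : (if m + p = 0 then (m : ℂ) * ((c • A) * (d • B)).trace else 0) =
          (c * d) * (if m + p = 0 then (m : ℂ) * (A * B).trace else 0) := by
        split_ifs
        · rw [smul_mul_smul_comm, Matrix.trace_smul, smul_eq_mul]; ring
        · rw [mul_zero]
      rw [e, e', map_smul, map_smul, map_smul, smul_mul_smul_comm, smul_mul_smul_comm,
        mul_comm d c, ← smul_sub, mul_smul_comm, h3, mul_smul_comm, smul_add, smul_neg, smul_smul]

/-- The field correcting the lift points in direction (-m)^+, just within reach of (-m)^+ + 1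
integrations. Its form is nonzero on that direction only for m = 0 and u = v, so a trace is the only
obstruction. -/
lemma piTEnd_pow_mul_fieldDeriv_mul_piTEnd (m : ℤ) (u v : Fin n) :
    piTEnd n ^ (-m).toNat * fieldDeriv (unitMode m u v) * piTEnd n =
      piTEnd n ^ ((-m).toNat + 1) * fieldDeriv (unitMode m u v) +
      (if m = 0 ∧ u = v then (1 : ℂ) else 0) • piTEnd n ^ ((-m).toNat + 1) := by
  rw [mul_assoc, ← piTEnd_mul_fieldDeriv (unitMode_sub_smulRight_mulTInv m u v), ← mul_assoc,
    ← pow_succ, fieldDeriv_sub, mul_sub, piTEnd_pow_mul_fieldDeriv_smulRight (Nat.lt_succ_self _),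
    neg_smul, sub_neg_eq_add, coeff_basisVec]
  congr 2
  by_cases hm : m = 0
  · subst hm
    by_cases huv : u = v
    · simp [huv]
    · simp [huv, Ne.symm huv]
  · simp [hm]

lemma piTEnd_pow_mul_modeDeriv_mul_piTEnd (m : ℤ) (a : Matrix (Fin n) (Fin n) ℂ) :
    piTEnd n ^ (-m).toNat * modeDeriv m a * piTEnd n =
      piTEnd n ^ ((-m).toNat + 1) * modeDeriv m a +
      (if m = 0 then a.trace else 0) • piTEnd n ^ ((-m).toNat + 1) := by
  have h : (if m = 0 then a.trace else 0) =
      ∑ u, ∑ v, a u v * (if m = 0 ∧ u = v then (1 : ℂ) else 0) := by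
    by_cases hm : m = 0
    · simp [hm, Matrix.trace]
    · simp [hm]
  simp only [h, modeDeriv_apply, Finset.mul_sum, Finset.sum_mul, Finset.sum_smul,
    ← Finset.sum_add_distrib, mul_smul_comm, smul_mul_assoc,
    piTEnd_pow_mul_fieldDeriv_mul_piTEnd, smul_add, smul_smul]

lemma piTEnd_pow_mul_modeDeriv_mul_piTEnd_pow (m : ℤ) {a : Matrix (Fin n) (Fin n) ℂ}
    (ha : a.trace = 0) (i : ℕ) :
    piTEnd n ^ (-m).toNat * modeDeriv m a * piTEnd n ^ i =
      piTEnd n ^ ((-m).toNat + i) * modeDeriv m a := by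
  induction i with
  | zero => simp
  | succ i ih =>
    rw [pow_succ, ← mul_assoc, ih, add_comm, pow_add, mul_assoc, mul_assoc,
      ← mul_assoc (piTEnd n ^ (-m).toNat), piTEnd_pow_mul_modeDeriv_mul_piTEnd, ha, ite_self,
      zero_smul, add_zero, ← mul_assoc, ← pow_add]
    congr 2
    omega

end NegLoop

/-! ### Comparison with the coordinate formulas, and the action on eigenfunctions. -/

namespace NegLoop

variable {n : ℕ}

lemma exists_forall_ge_apply_eq_zero (x : NegLoop n) : ∃ M, ∀ k, M ≤ k → x k = 0 := by
  refine ⟨x.support.sup id + 1, fun k hk => ?_⟩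
  by_contra h
  have := Finset.le_sup (f := id) (Finsupp.mem_support_iff.2 h)
  simp only [id] at this
  omega

lemma unitMode_natCast_apply {x : NegLoop n} {M : ℕ} (hM : ∀ k, M ≤ k → x k = 0) (j : ℕ)
    (u v : Fin n) :
    unitMode j u v x = ∑ k ∈ Finset.range M, x (k + j) v • basisVec k u := by
  refine Finsupp.ext fun l => funext fun w => ?_
  rw [unitMode_apply, coeff_apply, if_pos (show 0 ≤ (l : ℤ) + j by omega),
    show ((l : ℤ) + j).toNat = l + j by omega]
  simp only [Finsupp.finsetSum_apply, Finset.sum_apply, Finsupp.smul_apply, Pi.smul_apply,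
    basisVec_apply, smul_eq_mul, mul_ite, mul_one, mul_zero]
  by_cases hw : w = u
  · simp only [hw, if_true, and_true, Finset.sum_ite_eq, Finset.mem_range]
    split_ifs with hl
    · rfl
    · rw [hM _ (by omega), Pi.zero_apply]
  · simp [hw]

lemma unitMode_neg_natCast_apply {x : NegLoop n} {M : ℕ} (hM : ∀ k, M ≤ k → x k = 0) (j : ℕ)
    (u v : Fin n) :
    unitMode (-j) u v x = ∑ k ∈ Finset.range M, x k v • basisVec (k + j) u := by
  refine Finsupp.ext fun l => funext fun w => ?_
  rw [unitMode_apply, coeff_apply]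
  simp only [Finsupp.finsetSum_apply, Finset.sum_apply, Finsupp.smul_apply, Pi.smul_apply,
    basisVec_apply, smul_eq_mul, mul_ite, mul_one, mul_zero]
  by_cases hw : w = u
  · simp only [hw, if_true, and_true]
    by_cases hl : j ≤ l
    · obtain ⟨i, rfl⟩ := Nat.exists_eq_add_of_le' hl
      rw [if_pos (by omega), show (((i + j : ℕ) : ℤ) + -(j : ℤ)).toNat = i by omega]
      simp only [Nat.add_right_cancel_iff, Finset.sum_ite_eq, Finset.mem_range]
      split_ifs with hi
      · rfl
      · rw [hM _ (by omega), Pi.zero_apply]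
    · rw [if_neg (by omega)]
      exact (Finset.sum_eq_zero fun k _ => if_neg (by omega)).symm
  · simp [hw]

lemma finsum_eq_sum_range {M : ℕ} {c : ℕ → ℂ} (hc : ∀ k, M ≤ k → c k = 0) :
    ∑ᶠ k, c k = ∑ k ∈ Finset.range M, c k :=
  finsum_eq_sum_of_support_subset _ fun k hk => by
    by_contra h
    exact hk (hc k (by simpa using h))

lemma lineDeriv_sum_smul {f : NegLoop n → ℂ} (hf : IsSchwartz f) (x : NegLoop n) (M : ℕ)
    (c : ℕ → ℝ) (w : ℕ → NegLoop n) :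
    lineDeriv ℝ f x (∑ k ∈ Finset.range M, c k • w k) =
      ∑ k ∈ Finset.range M, (c k : ℂ) * lineDeriv ℝ f x (w k) := by
  rw [← hf.differential_apply, map_sum]
  exact Finset.sum_congr rfl fun k _ => by
    rw [map_smul, Complex.real_smul, hf.differential_apply]

lemma nonnegModeOp_eq (u v : Fin n) (j : ℕ) (f : SchwartzFn n) :
    nonnegModeOp u v j f.1 = -(fieldDeriv (unitMode j u v) f).1 := by
  funext x
  obtain ⟨M, hM⟩ := exists_forall_ge_apply_eq_zero x
  rw [Pi.neg_apply, fieldDeriv_apply, unitMode_natCast_apply hM, lineDeriv_sum_smul f.2,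
    nonnegModeOp, finsum_eq_sum_range (M := M)]
  · rfl
  · intro k hk
    rw [hM _ (by omega)]
    simp

lemma loweringSum_eq (u v : Fin n) (j : ℕ) (f : SchwartzFn n) :
    loweringSum u v j f.1 = (fieldDeriv (unitMode (-j) u v) f).1 := by
  funext x
  obtain ⟨M, hM⟩ := exists_forall_ge_apply_eq_zero x
  rw [fieldDeriv_apply, unitMode_neg_natCast_apply hM, lineDeriv_sum_smul f.2,
    loweringSum, finsum_eq_sum_range (M := M)]
  · rfl
  · intro k hk
    rw [hM _ hk]
    simp

lemma finsum_loweringSum_sub (u v : Fin n) (j : ℕ) (f : SchwartzFn n) :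
    (fun x => ∑ᶠ k : ℕ, ((x k u : ℂ) * partialDeriv (k + j) u f.1 x -
      (x k v : ℂ) * partialDeriv (k + j) v f.1 x)) =
      (fieldDeriv (unitMode (-j) u u) f - fieldDeriv (unitMode (-j) v v) f).1 := by
  funext x
  obtain ⟨M, hM⟩ := exists_forall_ge_apply_eq_zero x
  refine Eq.trans ?_ (congrArg₂ (· - ·) (congrFun (loweringSum_eq u u j f) x)
    (congrFun (loweringSum_eq v v j f) x))
  have h (w : Fin n) (k : ℕ) (hk : M ≤ k) : (x k w : ℂ) * partialDeriv (k + j) w f.1 x = 0 := by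
    rw [hM k hk]
    simp
  rw [loweringSum, loweringSum, finsum_eq_sum_range (h u), finsum_eq_sum_range (h v),
    finsum_eq_sum_range fun k hk => by rw [h u k hk, h v k hk, sub_zero], Finset.sum_sub_distrib]

/-- The operator of `a t^m`, on all Schwartz functions. -/
def modeAction (lam : ℂ) (m : ℤ) : Matrix (Fin n) (Fin n) ℂ →ₗ[ℂ] Module.End ℂ (SchwartzFn n) :=
  (-(lam ^ (-m).toNat)⁻¹) • LinearMap.mulLeft ℂ (piTEnd n ^ (-m).toNat) ∘ₗ modeDeriv m

lemma modeAction_apply (lam : ℂ) (m : ℤ) (a : Matrix (Fin n) (Fin n) ℂ) (f : SchwartzFn n) :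
    modeAction lam m a f =
      (-(lam ^ (-m).toNat)⁻¹) • (piTEnd n ^ (-m).toNat * modeDeriv m a) f := rfl

lemma piTEnd_pow_apply {lam : ℂ} {f : SchwartzFn n} (hf : piTEnd n f = lam • f) (i : ℕ) :
    (piTEnd n ^ i) f = lam ^ i • f := by
  induction i with
  | zero => simp
  | succ i ih => rw [pow_succ, Module.End.mul_apply, hf, map_smul, ih, smul_smul, pow_succ']

/-- Powers of π_t beyond the (-m)^+ needed for the mode pass through it and act on f by λ. -/
lemma piTEnd_pow_mul_modeDeriv_apply {lam : ℂ} {f : SchwartzFn n} (hf : piTEnd n f = lam • f)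
    (m : ℤ) {a : Matrix (Fin n) (Fin n) ℂ} (ha : a.trace = 0) (i : ℕ) :
    (piTEnd n ^ ((-m).toNat + i) * modeDeriv m a) f =
      lam ^ i • (piTEnd n ^ (-m).toNat * modeDeriv m a) f := by
  rw [← piTEnd_pow_mul_modeDeriv_mul_piTEnd_pow m ha, Module.End.mul_apply,
    piTEnd_pow_apply hf, map_smul]

/-- The modes of traceless matrices preserve the eigenspaces of `π_t`. -/
lemma piTEnd_modeAction {lam : ℂ} {f : SchwartzFn n} (hf : piTEnd n f = lam • f) (m : ℤ)
    {a : Matrix (Fin n) (Fin n) ℂ} (ha : a.trace = 0) :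
    piTEnd n (modeAction lam m a f) = lam • modeAction lam m a f := by
  have h := piTEnd_pow_mul_modeDeriv_apply hf m ha 1
  rw [pow_one, pow_succ', mul_assoc, Module.End.mul_apply] at h
  rw [modeAction_apply, map_smul, h, smul_comm]

/-- The inner power of π_t crosses only the outer mode, so only `a` must be traceless and f is
arbitrary. The resulting power is symmetric in m and p, which makes the two products comparable. -/
lemma modeAction_mul_apply {lam : ℂ} (m p : ℤ) {a : Matrix (Fin n) (Fin n) ℂ}
    (ha : a.trace = 0) (b : Matrix (Fin n) (Fin n) ℂ) (f : SchwartzFn n) :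
    modeAction lam m a (modeAction lam p b f) =
      (lam ^ ((-m).toNat + (-p).toNat))⁻¹ •
        (piTEnd n ^ ((-m).toNat + (-p).toNat) * (modeDeriv m a * modeDeriv p b)) f := by
  rw [modeAction_apply, modeAction_apply, map_smul, smul_smul, neg_mul_neg, ← mul_inv, ← pow_add,
    ← mul_assoc, ← piTEnd_pow_mul_modeDeriv_mul_piTEnd_pow m ha]
  rfl

lemma modeAction_comm {lam : ℂ} (hlam : lam ≠ 0) {f : SchwartzFn n} (hf : piTEnd n f = lam • f)
    (m p : ℤ) {a b : Matrix (Fin n) (Fin n) ℂ} (ha : a.trace = 0) (hb : b.trace = 0) :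
    modeAction lam m a (modeAction lam p b f) - modeAction lam p b (modeAction lam m a f) =
      modeAction lam (m + p) (a * b - b * a) f +
        (if m + p = 0 then (m : ℂ) * (a * b).trace else 0) • f := by
  set q := (-m).toNat + (-p).toNat with hq
  have hab : (a * b - b * a).trace = 0 := by
    rw [Matrix.trace_sub, Matrix.trace_mul_comm, sub_self]
  -- Negative parts are subadditive. The surplus `r` contributes λ^r, reducing λ^{-q} to the
  -- normalization of the mode m + p.
  obtain ⟨r, hr⟩ : ∃ r, q = (-(m + p)).toNat + r := ⟨q - (-(m + p)).toNat, by omega⟩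
  have hcomm := piTEnd_pow_mul_modeDeriv_comm (q := q) (m := m) (p := p) (by omega) (by omega) a b
  have h1 : (piTEnd n ^ q * modeDeriv (m + p) (a * b - b * a)) f =
      lam ^ r • (piTEnd n ^ (-(m + p)).toNat * modeDeriv (m + p) (a * b - b * a)) f := by
    rw [hr, piTEnd_pow_mul_modeDeriv_apply hf _ hab]
  have hscal : (lam ^ q)⁻¹ * lam ^ r = (lam ^ (-(m + p)).toNat)⁻¹ := by
    rw [hr, pow_add]
    field_simp
  have hq' : (lam ^ q)⁻¹ * lam ^ q = 1 := inv_mul_cancel₀ (pow_ne_zero _ hlam)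
  rw [modeAction_mul_apply m p ha, modeAction_mul_apply p m hb,
    add_comm (-p).toNat, ← hq, ← smul_sub, ← LinearMap.sub_apply, ← mul_sub, hcomm,
    LinearMap.add_apply, LinearMap.neg_apply, LinearMap.smul_apply, piTEnd_pow_apply hf, h1,
    smul_add, smul_neg, smul_smul, hscal, smul_comm, smul_smul _ _ f, hq', one_smul,
    modeAction_apply, neg_smul]

/-- The underlying function of a Schwartz function, as a linear map. -/
def SchwartzFn.coeLin (n : ℕ) : SchwartzFn n →ₗ[ℂ] NegLoop n → ℂ where
  toFun f := f.1
  map_add' _ _ := rfl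
  map_smul' _ _ := rfl

lemma modeAction_natCast_coe (lam : ℂ) (j : ℕ) (a : Matrix (Fin n) (Fin n) ℂ)
    (f : SchwartzFn n) :
    (modeAction lam j a f).1 = ∑ u, ∑ v, a u v • nonnegModeOp u v j f.1 := by
  have h : modeAction lam j a f = -modeDeriv j a f := by
    rw [modeAction_apply, show (-(j : ℤ)).toNat = 0 by omega, pow_zero, pow_zero, inv_one,
      one_mul, neg_one_smul]
  refine Eq.trans (show _ = SchwartzFn.coeLin n (modeAction lam j a f) from rfl) ?_
  rw [h, map_neg, modeDeriv_apply]
  simp only [LinearMap.sum_apply, LinearMap.smul_apply, map_sum, map_smul, nonnegModeOp_eq,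
    smul_neg, Finset.sum_neg_distrib]
  rfl

/-- The inclusion of the eigenspace into the space of Schwartz functions. -/
def eigenspaceIncl (n : ℕ) (lam : ℂ) : schwartzEigenspace n lam →ₗ[ℂ] SchwartzFn n where
  toFun f := ⟨f.1, f.2.1⟩
  map_add' _ _ := rfl
  map_smul' _ _ := rfl

lemma piTEnd_eigenspaceIncl {lam : ℂ} (f : schwartzEigenspace n lam) :
    piTEnd n (eigenspaceIncl n lam f) = lam • eigenspaceIncl n lam f :=
  Subtype.ext f.2.2

lemma eigenspaceIncl_injective (n : ℕ) (lam : ℂ) : Function.Injective (eigenspaceIncl n lam) :=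
  fun _ _ h => Subtype.ext (congrArg (fun g : SchwartzFn n => g.1) h)

end NegLoop

/-! ### The representation of the affine algebra and its uniqueness. -/

namespace AffineSl

open NegLoop

variable {n : ℕ}

lemma trace_val_eq_zero (a : Sl n) : a.val.trace = 0 := a.2

/-- The action of the modes `a t^m` on the eigenspace. -/
def eigenAction (lam : ℂ) (m : ℤ) :
    Sl n →ₗ[ℂ] Module.End ℂ (schwartzEigenspace n lam) where
  toFun a :=
    { toFun := fun f =>
        ⟨(modeAction lam m a.val (eigenspaceIncl n lam f)).1,
          (modeAction lam m a.val (eigenspaceIncl n lam f)).2,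
          congrArg (fun g : SchwartzFn n => g.1)
            (piTEnd_modeAction (piTEnd_eigenspaceIncl f) m (trace_val_eq_zero a))⟩
      map_add' := fun f g => Subtype.ext <| congrArg (fun g : SchwartzFn n => g.1) <|
        ((modeAction lam m a.val) ∘ₗ eigenspaceIncl n lam).map_add f g
      map_smul' := fun c f => Subtype.ext <| congrArg (fun g : SchwartzFn n => g.1) <|
        ((modeAction lam m a.val) ∘ₗ eigenspaceIncl n lam).map_smul c f }
  map_add' a b := LinearMap.ext fun f => Subtype.ext <|
    congrArg (fun g : SchwartzFn n => g.1) <|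
      LinearMap.congr_fun ((modeAction lam m).map_add a.val b.val) (eigenspaceIncl n lam f)
  map_smul' c a := LinearMap.ext fun f => Subtype.ext <|
    congrArg (fun g : SchwartzFn n => g.1) <|
      LinearMap.congr_fun ((modeAction lam m).map_smul c a.val) (eigenspaceIncl n lam f)

lemma eigenAction_coe (lam : ℂ) (m : ℤ) (a : Sl n) (f : schwartzEigenspace n lam) :
    (eigenAction lam m a f : NegLoop n → ℂ) =
      (modeAction lam m a.val (eigenspaceIncl n lam f)).1 := rfl

lemma eigenAction_comm {lam : ℂ} (hlam : lam ≠ 0) (m p : ℤ) (a b : Sl n) :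
    ⁅(eigenAction lam m a : Module.End ℂ (schwartzEigenspace n lam)), eigenAction lam p b⁆ =
      eigenAction lam (m + p) ⁅a, b⁆ +
        (if m + p = 0 then (m : ℂ) * (a.val * b.val).trace else 0) • 1 :=
  LinearMap.ext fun f => eigenspaceIncl_injective n lam <|
    modeAction_comm hlam (piTEnd_eigenspaceIncl f) m p (trace_val_eq_zero a) (trace_val_eq_zero b)

/-- The linear map underlying the representation. -/
def rep (n : ℕ) (lam : ℂ) : Affine n →ₗ[ℂ] Module.End ℂ (schwartzEigenspace n lam) where
  toFun x :=
    Finsupp.lsum ℂ (eigenAction lam) (LoopAlgebra.toFinsupp ℂ ℤ (Sl n) ((ofProd _).symm x).1) +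
      TrivialLieModule.equiv ℂ (loopAlgebra ℂ ℤ (Sl n)) ℂ ((ofProd _).symm x).2 • 1
  map_add' x y := by
    rw [of_symm_add, Prod.fst_add, Prod.snd_add, map_add, map_add, map_add, add_smul,
      add_add_add_comm]
  map_smul' c x := by
    rw [of_symm_smul, Prod.smul_fst, Prod.smul_snd, map_smul, map_smul, map_smul, smul_assoc,
      smul_add, RingHom.id_apply]

lemma rep_mode (lam : ℂ) (a : Sl n) (m : ℤ) : rep n lam (mode a m) = eigenAction lam m a := by
  change Finsupp.lsum ℂ (eigenAction lam) (LoopAlgebra.toFinsupp ℂ ℤ (Sl n)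
    (AddMonoidAlgebra.single m 1 ⊗ₜ[ℂ] a)) + (0 : ℂ) • 1 = _
  rw [LoopAlgebra.toFinsupp_single_tmul, Finsupp.lsum_single, zero_smul, add_zero]

lemma rep_K (lam : ℂ) : rep n lam (K n) = 1 := by
  change Finsupp.lsum ℂ (eigenAction lam) (LoopAlgebra.toFinsupp ℂ ℤ (Sl n) 0) + (1 : ℂ) • 1 = _
  rw [map_zero, map_zero, one_smul, zero_add]

/-- The modes and the central element span the affine algebra. -/
lemma affine_induction {P : Affine n → Prop} (hmode : ∀ a m, P (mode a m)) (hK : P (K n))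
    (hadd : ∀ x y, P x → P y → P (x + y)) (hsmul : ∀ (c : ℂ) x, P x → P (c • x))
    (x : Affine n) : P x := by
  have h0 : P 0 := by simpa using hsmul 0 _ hK
  have h1 (g : ℤ →₀ Sl n) : P (ofProd _ ((LoopAlgebra.toFinsupp ℂ ℤ (Sl n)).symm g, 0)) := by
    induction g using Finsupp.induction_linear with
    | zero => rwa [map_zero, Prod.mk_zero_zero, of_zero]
    | add g h hg hh =>
      have := hadd _ _ hg hh
      rwa [← of_add, Prod.mk_add_mk, ← map_add, add_zero] at this
    | single m a =>
      rw [LoopAlgebra.toFinsupp_symm_single]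
      exact hmode a m
  have h2 := hadd _ _ (h1 (LoopAlgebra.toFinsupp ℂ ℤ (Sl n) ((ofProd _).symm x).1))
    (hsmul (TrivialLieModule.equiv ℂ (loopAlgebra ℂ ℤ (Sl n)) ℂ ((ofProd _).symm x).2) _ hK)
  convert h2 using 1
  rw [K, ← of_smul, ← of_add, Prod.smul_mk, Prod.mk_add_mk, smul_zero, add_zero, zero_add,
    ← map_smul, smul_eq_mul, mul_one, LinearEquiv.symm_apply_apply, LinearEquiv.symm_apply_apply]
  rfl

lemma lie_one_left {V : Type*} [AddCommGroup V] [Module ℂ V] (f : Module.End ℂ V) :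
    ⁅(1 : Module.End ℂ V), f⁆ = 0 := by
  rw [Ring.lie_def, one_mul, mul_one, sub_self]

lemma lie_one_right {V : Type*} [AddCommGroup V] [Module ℂ V] (f : Module.End ℂ V) :
    ⁅f, (1 : Module.End ℂ V)⁆ = 0 := by
  rw [Ring.lie_def, one_mul, mul_one, sub_self]

lemma rep_lie {lam : ℂ} (hlam : lam ≠ 0) (x y : Affine n) :
    rep n lam ⁅x, y⁆ = ⁅rep n lam x, rep n lam y⁆ := by
  induction x using affine_induction with
  | hadd x x' hx hx' =>
    rw [add_lie, map_add, map_add, hx, hx']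
    exact (add_lie _ _ _).symm
  | hsmul c x hx =>
    rw [smul_lie, map_smul, map_smul, hx]
    exact (smul_lie _ _ _).symm
  | hK =>
    rw [← lie_skew, lie_K, neg_zero, map_zero, rep_K]
    exact (lie_one_left _).symm
  | hmode a m =>
    induction y using affine_induction with
    | hadd y y' hy hy' =>
      rw [lie_add, map_add, map_add, hy, hy']
      exact (lie_add _ _ _).symm
    | hsmul c y hy =>
      rw [lie_smul, map_smul, map_smul, hy]
      exact (lie_smul _ _ _).symm
    | hK =>
      rw [lie_K, map_zero, rep_K]
      exact (lie_one_right _).symm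
    | hmode b p =>
      rw [lie_mode_mode, map_add, map_smul, rep_K, rep_mode, rep_mode, rep_mode,
        eigenAction_comm hlam]

lemma rep_hasModeFormulas (n : ℕ) (lam : ℂ) : HasModeFormulas lam (rep n lam) where
  nonneg a j f := by
    rw [rep_mode, eigenAction_coe, modeAction_natCast_coe]
    rfl
  neg_offDiag u v huv j hj f := by
    rw [rep_mode, eigenAction_coe, modeAction_apply, show (- -(j : ℤ)).toNat = j by omega,
      SpecialLinear.val_single, modeDeriv_single, one_smul, negModeOffDiag]
    refine congrArg (fun g => (-(lam ^ j)⁻¹) • g) ?_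
    exact (piTEnd_pow_coe j _).trans
      (congrArg (piT^[j]) (loweringSum_eq u v j (eigenspaceIncl n lam f)).symm)
  neg_diag u v huv j hj f := by
    rw [rep_mode, eigenAction_coe, modeAction_apply, show (- -(j : ℤ)).toNat = j by omega,
      SpecialLinear.val_singleSubSingle, map_sub, modeDeriv_single, modeDeriv_single, one_smul,
      one_smul, negModeDiag]
    refine congrArg (fun g => (-(lam ^ j)⁻¹) • g) ?_
    exact (piTEnd_pow_coe j _).trans
      (congrArg (piT^[j]) (finsum_loweringSum_sub u v j (eigenspaceIncl n lam f)).symm)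

/-- Linear maps on `sl_n` agreeing on the standard generators are equal. -/
lemma sl_linearMap_ext {V : Type*} [AddCommMonoid V] [Module ℂ V] {g h : Sl n →ₗ[ℂ] V}
    (hoff : ∀ (u v : Fin n) (huv : u ≠ v),
      g (SpecialLinear.single u v huv 1) = h (SpecialLinear.single u v huv 1))
    (hdiag : ∀ u v : Fin n, u ≠ v →
      g (SpecialLinear.singleSubSingle u v 1) = h (SpecialLinear.singleSubSingle u v 1)) :
    g = h := by
  refine LinearMap.ext fun a => ?_
  rcases isEmpty_or_nonempty (Fin n) with hn | ⟨⟨o⟩⟩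
  · have : a = 0 := Subtype.ext (Matrix.ext fun i => hn.elim i)
    rw [this, map_zero, map_zero]
  -- Every diagonal entry is compensated at one fixed index `o`. The compensations add up to tr(a)
  -- at `o`, which vanishes.
  have ha : a = ∑ u, ∑ v, if huv : u ≠ v then a.val u v • SpecialLinear.single u v huv (1 : ℂ)
      else a.val u u • SpecialLinear.singleSubSingle u o (1 : ℂ) := by
    refine Subtype.ext ?_
    have h1 : ∀ u v, ((if huv : u ≠ v then a.val u v • SpecialLinear.single u v huv (1 : ℂ)
        else a.val u u • SpecialLinear.singleSubSingle u o (1 : ℂ) : Sl n) :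
          Matrix (Fin n) (Fin n) ℂ) = Matrix.single u v (a.val u v) -
            (if u = v then a.val u u else 0) • Matrix.single o o 1 := fun u v => by
      by_cases huv : u = v
      · subst huv
        simp [smul_sub]
      · simp [huv]
    rw [AddSubmonoidClass.coe_finsetSum]
    simp only [AddSubmonoidClass.coe_finsetSum, h1, Finset.sum_sub_distrib, ← Finset.sum_smul]
    rw [← Matrix.matrix_eq_sum_single]
    have : ∑ u, a.val u u = 0 := trace_val_eq_zero a
    simp [this]
  rw [ha]
  simp only [map_sum]
  refine Finset.sum_congr rfl fun u _ => Finset.sum_congr rfl fun v _ => ?_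
  split_ifs with huv
  · rw [map_smul, map_smul, hoff]
  · rw [map_smul, map_smul]
    by_cases huo : u = o
    · have : SpecialLinear.singleSubSingle u o (1 : ℂ) = 0 := Subtype.ext (by simp [huo])
      rw [this, map_zero, map_zero]
    · rw [hdiag u o huo]

/-- The map `a ↦ a t^m`. -/
def modeLin (n : ℕ) (m : ℤ) : Sl n →ₗ[ℂ] Affine n where
  toFun a := mode a m
  map_add' a b := by
    simp only [mode, ← of_add, TensorProduct.tmul_add, Prod.mk_add_mk, add_zero]
  map_smul' c a := by
    simp only [mode, ← of_smul, TensorProduct.tmul_smul, Prod.smul_mk, smul_zero, RingHom.id_apply]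

lemma HasModeFormulas.eq {lam : ℂ}
    {π ρ : Affine n →ₗ[ℂ] Module.End ℂ (schwartzEigenspace n lam)}
    (hπ : HasModeFormulas lam π) (hρ : HasModeFormulas lam ρ) (hK : π (K n) = ρ (K n)) :
    π = ρ := by
  refine LinearMap.ext fun x => ?_
  induction x using affine_induction with
  | hadd x y hx hy => rw [map_add, map_add, hx, hy]
  | hsmul c x hx => rw [map_smul, map_smul, hx]
  | hK => exact hK
  | hmode a m =>
    obtain ⟨j, rfl | rfl⟩ := m.eq_nat_or_neg
    · exact LinearMap.ext fun f => Subtype.ext <| (hπ.nonneg a j f).trans (hρ.nonneg a j f).symm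
    -- The exponent -0 also falls in this branch, and only the formula for nonnegative modes covers
    -- it.
    · rcases j.eq_zero_or_pos with rfl | hj
      · exact LinearMap.ext fun f => Subtype.ext <| (hπ.nonneg a 0 f).trans (hρ.nonneg a 0 f).symm
      · have h : π ∘ₗ modeLin n (-j) = ρ ∘ₗ modeLin n (-j) := sl_linearMap_ext
          (fun u v huv => LinearMap.ext fun f => Subtype.ext <|
            (hπ.neg_offDiag u v huv j hj f).trans (hρ.neg_offDiag u v huv j hj f).symm)
          (fun u v huv => LinearMap.ext fun f => Subtype.ext <|
            (hπ.neg_diag u v huv j hj f).trans (hρ.neg_diag u v huv j hj f).symm)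
        exact LinearMap.congr_fun h a

end AffineSl

end

theorem theorem4p2 (n : ℕ) (lam : ℂ) (hlam : lam ≠ 0) :
    ∃ ρ : AffineSl.Affine n →ₗ⁅ℂ⁆ Module.End ℂ (NegLoop.schwartzEigenspace n lam),
      AffineSl.HasModeFormulas lam (ρ : AffineSl.Affine n →ₗ[ℂ] _) ∧
      ρ (AffineSl.K n) = 1 ∧
      ∀ π : AffineSl.Affine n →ₗ[ℂ] Module.End ℂ (NegLoop.schwartzEigenspace n lam),
        AffineSl.HasModeFormulas lam π → π (AffineSl.K n) = 1 → π = ρ :=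
  ⟨{ AffineSl.rep n lam with map_lie' := fun {x y} => AffineSl.rep_lie hlam x y },
    AffineSl.rep_hasModeFormulas n lam, AffineSl.rep_K lam, fun _ hπ hK =>
      hπ.eq (AffineSl.rep_hasModeFormulas n lam) (hK.trans (AffineSl.rep_K lam).symm)⟩
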